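/- Let $M$ be a smooth manifold of dimension $n\ge 2$ and let $V_{n-1}$ be a smooth $(n-1)$-vector field on $M$ with $(V_{n-1})_{x_0}\neq 0$ at a point $x_0\in M$. Say that $V_{n-1}$ has constant coefficients on a neighbourhood of $x_0$ if there is a coordinate system $(u^1,\dots,u^n)$ centred at $x_0$ such that all the functions $V_{n-1}(du^{i_1},\dots,du^{i_{n-1}})$, $1\le i_1<\dots<i_{n-1}\le n$, are constant on the coordinate domain. Then $V_{n-1}$ has constant coefficients on a neighbourhood of $x_0$ if and only if there is an open neighbourhood $U$ of $x_0$ such that the following two conditions hold: (1) The Pfaffian system $P=\{w\in T_x^*M : i_w(V_{n-1})_x=0,\ x\in U\}$ has locally constant rank on $U$; every $x\in U$ has an open neighbourhood $U_x\subseteq U$ such that $\Gamma(U_x,P)$ admits a basis of closed $1$-forms (that is, $P|_{U_x}$ has a smooth frame of closed $1$-forms); and $P$ is integrable on $U$, i.e. the distribution $\ker P$ of the tangent vectors annihilated by all of $P$ is involutive. (2) Let $\eta$ be the $\wedge^nTM$-valued $1$-form $\eta(X)=X\wedge V_{n-1}$. There exists a derivation law $\nabla\colon \mathfrak X(U)\times\Gamma(U,\wedge^nTM)\to\Gamma(U,\wedge^nTM)$,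 $(X,W)\mapsto\nabla_XW$ (additive in both arguments, with $\nabla_{fX}W=f\nabla_XW$ and $\nabla_X(fW)=X(f)W+f\nabla_XW$ for $f\in C^\infty(U)$), with vanishing curvature, $\nabla_X\nabla_YW-\nabla_Y\nabla_XW-\nabla_{[X,Y]}W=0$, such that $d^\nabla\eta=0$ on $U$, where $(d^\nabla\eta)(X,Y)=\nabla_X(\eta(Y))-\nabla_Y(\eta(X))-\eta([X,Y])$. -/

import Mathlib

open scoped Manifold ContDiff Topology

noncomputable section

namespace ConstCoeff

section Algebra

variable {T : Type*} [AddCommGroup T] [Module ℝ T]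

/-- The value `V(w₁, …, w_q)` of a `q`-vector on `q` covectors: on decomposable `q`-vectors it is
`(v₁ ∧ ⋯ ∧ v_q)(w₁, …, w_q) = det (w_i(v_j))`. -/
def evalCovectors {q : ℕ} (V : ⋀[ℝ]^q T) (w : Fin q → Module.Dual ℝ T) : ℝ :=
  exteriorPower.pairingDual ℝ T q (exteriorPower.ιMulti ℝ q w) V

/-- The exterior product `v ∧ V` of a vector and a `q`-vector. -/
def wedge {q : ℕ} (v : T) (V : ⋀[ℝ]^q T) : ⋀[ℝ]^(q + 1) T :=
  ⟨ExteriorAlgebra.ι ℝ v * (V : ExteriorAlgebra ℝ T), by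
    change _ ∈ LinearMap.range (ExteriorAlgebra.ι ℝ : T →ₗ[ℝ] ExteriorAlgebra ℝ T) ^ (q + 1)
    rw [pow_succ']
    exact Submodule.mul_mem_mul (LinearMap.mem_range_self _ v) V.2⟩

/-- The covectors `w` with `i_w V = 0`, where `i_w` is the interior product. -/
def annihilator {q : ℕ} (V : ⋀[ℝ]^q T) : Submodule ℝ (Module.Dual ℝ T) :=
  LinearMap.ker ((CliffordAlgebra.contractLeft (Q := (0 : QuadraticForm ℝ T))).flip
    (V : ExteriorAlgebra ℝ T))

end Algebra

/-! Fields and forms are functions on all of `M`. A section over an open set `U` is represented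
by any such function: only its values on `U` are ever used. -/

variable {n : ℕ} {M : Type*} [TopologicalSpace M] [ChartedSpace (EuclideanSpace ℝ (Fin n)) M]

/-- (Not necessarily smooth) vector fields. -/
abbrev VField (n : ℕ) (M : Type*) [TopologicalSpace M]
    [ChartedSpace (EuclideanSpace ℝ (Fin n)) M] : Type _ :=
  (x : M) → TangentSpace (𝓡 n) x

/-- (Not necessarily smooth) `q`-vector fields. -/
abbrev MVField (n : ℕ) (M : Type*) [TopologicalSpace M]
    [ChartedSpace (EuclideanSpace ℝ (Fin n)) M] (q : ℕ) : Type _ :=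
  (x : M) → ⋀[ℝ]^q (TangentSpace (𝓡 n) x)

/-- (Not necessarily smooth) `1`-forms. -/
abbrev OneForm (n : ℕ) (M : Type*) [TopologicalSpace M]
    [ChartedSpace (EuclideanSpace ℝ (Fin n)) M] : Type _ :=
  (x : M) → Module.Dual ℝ (TangentSpace (𝓡 n) x)

/-- The differential `df` of a function. -/
def differential (n : ℕ) {M : Type*} [TopologicalSpace M]
    [ChartedSpace (EuclideanSpace ℝ (Fin n)) M] (f : M → ℝ) : OneForm n M :=
  fun x => (mfderiv (𝓡 n) 𝓘(ℝ, ℝ) f x : TangentSpace (𝓡 n) x →L[ℝ] ℝ).toLinearMap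

/-- Smooth functions on `U`. -/
def SmoothFun (n : ℕ) {M : Type*} [TopologicalSpace M]
    [ChartedSpace (EuclideanSpace ℝ (Fin n)) M] (f : M → ℝ) (U : Set M) : Prop :=
  ContMDiffOn (𝓡 n) 𝓘(ℝ, ℝ) ∞ f U

/-- The function `X(f) = df(X)`. -/
def lieDer (X : VField n M) (f : M → ℝ) : M → ℝ :=
  fun x => differential n f x (X x)

/-- A `q`-vector field is smooth on `U` if `V(df₁, …, df_q)` is smooth for all smooth functions
`f₁, …, f_q` on open subsets of `U`. -/
def SmoothMV {q : ℕ} (V : MVField n M q) (U : Set M) : Prop :=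
  ∀ W : Set M, IsOpen W → W ⊆ U → ∀ f : Fin q → M → ℝ, (∀ i, SmoothFun n (f i) W) →
    SmoothFun n (fun x => evalCovectors (V x) (fun i => differential n (f i) x)) W

/-- The `q`-vector field `V` has constant coefficients on a neighbourhood of `x₀`: there is a
coordinate system `(u¹, …, uⁿ)` centred at `x₀` on the domain of which all the functions
`V(du^{i₁}, …, du^{i_q})`, `i₁ < ⋯ < i_q`, are constant. -/
def HasConstantCoefficientsNear {q : ℕ} (V : MVField n M q) (x₀ : M) : Prop :=
  ∃ u ∈ IsManifold.maximalAtlas (𝓡 n) ∞ M, x₀ ∈ u.source ∧ u x₀ = 0 ∧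
    ∀ I : Fin q ↪o Fin n, ∃ c : ℝ, ∀ x ∈ u.source,
      evalCovectors (V x) (fun k => differential n (fun y => u y (I k)) x) = c

/-- The Pfaffian system `P = {w ∈ T*ₓM : i_w Vₓ = 0}` of a `q`-vector field. -/
def pfaffian {q : ℕ} (V : MVField n M q) (x : M) :
    Submodule ℝ (Module.Dual ℝ (TangentSpace (𝓡 n) x)) :=
  annihilator (V x)

variable [IsManifold (𝓡 n) ∞ M]

/-- Smooth vector fields on `U`. -/
def SmoothVF (X : VField n M) (U : Set M) : Prop :=
  ContMDiffOn (𝓡 n) (𝓡 n).tangent ∞ (fun x => (⟨x, X x⟩ : TangentBundle (𝓡 n) M)) U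

/-- Smooth `1`-forms on `U`. -/
def SmoothForm (ζ : OneForm n M) (U : Set M) : Prop :=
  ∀ W : Set M, IsOpen W → W ⊆ U → ∀ X : VField n M, SmoothVF X W →
    SmoothFun n (fun x => ζ x (X x)) W

/-- `ζ` is closed on `U`: `dζ(X, Y) = X(ζ(Y)) - Y(ζ(X)) - ζ([X, Y])` vanishes for all smooth vector
fields on open subsets of `U`. -/
def ClosedForm (ζ : OneForm n M) (U : Set M) : Prop :=
  ∀ W : Set M, IsOpen W → W ⊆ U → ∀ X Y : VField n M, SmoothVF X W → SmoothVF Y W →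
    ∀ x ∈ W, lieDer X (fun y => ζ y (Y y)) x - lieDer Y (fun y => ζ y (X y)) x
      - ζ x (VectorField.mlieBracket (𝓡 n) X Y x) = 0

/-- The field `P` of spaces of covectors has locally constant rank on `U`. -/
def LocallyConstantRank
    (P : (x : M) → Submodule ℝ (Module.Dual ℝ (TangentSpace (𝓡 n) x))) (U : Set M) : Prop :=
  ∀ x ∈ U, ∀ᶠ y in 𝓝 x, Module.finrank ℝ (P y) = Module.finrank ℝ (P x)

/-- Every point of `U` has an open neighbourhood on which the sections of `P` admit a basis
(a smooth frame of `P`) consisting of closed `1`-forms. -/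
def HasLocalClosedBases
    (P : (x : M) → Submodule ℝ (Module.Dual ℝ (TangentSpace (𝓡 n) x))) (U : Set M) : Prop :=
  ∀ x ∈ U, ∃ W : Set M, IsOpen W ∧ x ∈ W ∧ W ⊆ U ∧ ∃ (k : ℕ) (ζ : Fin k → OneForm n M),
    (∀ j, SmoothForm (ζ j) W ∧ ClosedForm (ζ j) W) ∧
    ∀ y ∈ W, LinearIndependent ℝ (fun j => ζ j y) ∧
      Submodule.span ℝ (Set.range fun j => ζ j y) = P y

/-- `P` is integrable on `U`: the distribution of the vectors on which all elements of `P` vanish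
is involutive. -/
def IsIntegrable
    (P : (x : M) → Submodule ℝ (Module.Dual ℝ (TangentSpace (𝓡 n) x))) (U : Set M) : Prop :=
  ∀ W : Set M, IsOpen W → W ⊆ U → ∀ X Y : VField n M, SmoothVF X W → SmoothVF Y W →
    (∀ x ∈ W, ∀ w ∈ P x, w (X x) = 0) → (∀ x ∈ W, ∀ w ∈ P x, w (Y x) = 0) →
    ∀ x ∈ W, ∀ w ∈ P x, w (VectorField.mlieBracket (𝓡 n) X Y x) = 0

/-- A derivation law `(X, W) ↦ ∇_X W` on the bundle `∧^r TM` over `U`: an operator on smooth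
sections over `U`, linear over the smooth functions on `U` in `X`, additive in `W`, with
`∇_X (f W) = X(f) W + f ∇_X W`. -/
structure DerivationLaw (n : ℕ) (M : Type*) [TopologicalSpace M]
    [ChartedSpace (EuclideanSpace ℝ (Fin n)) M] [IsManifold (𝓡 n) ∞ M] (r : ℕ) (U : Set M) where
  /-- the operator `∇` -/
  toFun : VField n M → MVField n M r → MVField n M r
  congr : ∀ X X' W W', SmoothVF X U → SmoothMV W U → (∀ x ∈ U, X x = X' x) →
    (∀ x ∈ U, W x = W' x) → ∀ x ∈ U, toFun X W x = toFun X' W' x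
  smooth : ∀ X W, SmoothVF X U → SmoothMV W U → SmoothMV (toFun X W) U
  add_left : ∀ X Y W, SmoothVF X U → SmoothVF Y U → SmoothMV W U →
    ∀ x ∈ U, toFun (X + Y) W x = toFun X W x + toFun Y W x
  smul_left : ∀ (f : M → ℝ) X W, SmoothFun n f U → SmoothVF X U → SmoothMV W U →
    ∀ x ∈ U, toFun (fun y => f y • X y) W x = f x • toFun X W x
  add_right : ∀ X W W', SmoothVF X U → SmoothMV W U → SmoothMV W' U →
    ∀ x ∈ U, toFun X (W + W') x = toFun X W x + toFun X W' x
  leibniz : ∀ (f : M → ℝ) X W, SmoothFun n f U → SmoothVF X U → SmoothMV W U →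
    ∀ x ∈ U, toFun X (fun y => f y • W y) x = lieDer X f x • W x + f x • toFun X W x

namespace DerivationLaw

variable {r : ℕ} {U : Set M}

/-- The curvature `R(X, Y)W = ∇_X ∇_Y W - ∇_Y ∇_X W - ∇_{[X, Y]} W`. -/
def curvature (D : DerivationLaw n M r U) (X Y : VField n M) (W : MVField n M r) :
    MVField n M r :=
  D.toFun X (D.toFun Y W) - D.toFun Y (D.toFun X W)
    - D.toFun (VectorField.mlieBracket (𝓡 n) X Y) W

/-- The curvature vanishes on `U`. -/
def IsFlat (D : DerivationLaw n M r U) : Prop :=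
  ∀ X Y W, SmoothVF X U → SmoothVF Y U → SmoothMV W U → ∀ x ∈ U, D.curvature X Y W x = 0

/-- The exterior covariant differential of a `∧^r TM`-valued `1`-form `η`,
`(d^∇ η)(X, Y) = ∇_X (η(Y)) - ∇_Y (η(X)) - η([X, Y])`. -/
def extCovDeriv (D : DerivationLaw n M r U) (η : VField n M → MVField n M r)
    (X Y : VField n M) : MVField n M r :=
  D.toFun X (η Y) - D.toFun Y (η X) - η (VectorField.mlieBracket (𝓡 n) X Y)

end DerivationLaw

/-- The `∧^{q+1} TM`-valued `1`-form `η(X) = X ∧ V`. -/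
def wedgeForm {n : ℕ} {M : Type*} [TopologicalSpace M]
    [ChartedSpace (EuclideanSpace ℝ (Fin n)) M] {q : ℕ} (V : MVField n M q) :
    VField n M → MVField n M (q + 1) :=
  fun X x => wedge (X x) (V x)

end ConstCoeff

end

noncomputable section

namespace ConstCoeff

/-! ### Interior products, evaluation on covectors and annihilators of multivectors. -/

section Algebra

variable {T : Type*} [AddCommGroup T] [Module ℝ T]
variable {S : Type*} [AddCommGroup S] [Module ℝ S]

/-! Suppose `V` is constant in a chart `e`. Then its Pfaffian system is the pullback by `de` of one
fixed space of covectors, so it is spanned by differentials of linear functions of the coordinates;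
these are closed, which gives (1) (`pfaffian_of_constant`). For (2), declare `∂₁ ∧ ⋯ ∧ ∂ₙ` parallel
(`chartLaw`). Then `X ∧ V` is `d(L ∘ e)(X)` times this frame for a fixed linear form `L`, so
flatness and `d^∇ η = 0` both reduce to `d² = 0` (`closedForm_differential`).

Conversely, write `n = m + 1`. Contraction with a generator of the top power identifies covectors
with `m`-vectors, so every `m`-vector is killed by a nonzero covector (`annihilator_ne_bot`). A
closed local frame of the Pfaffian system is therefore nonempty, and by the Poincaré lemma one of
its members is `df` near `x₀`. Taking `f` as the `i`-th coordinate leaves `V` a single component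
`K`, the one that omits `i`, since any component involving `i` vanishes; and `K x₀ ≠ 0`.

It remains to absorb `K`. As `n ≥ 2` there is an index `j ≠ i`. Integrating `1 / K` in the direction
`∂ⱼ` gives `G` with `∂ⱼ G = 1 / K` (`exists_partial_primitive`), and replacing the `j`-th coordinate
by `G` (`exists_chart_replaceCoord`) multiplies the surviving component by `∂ⱼ G`, making it `1`
(`evalCovectors_update`). The new coordinates are shifted to be centred at `x₀`. -/

theorem evalCovectors_eq {q : ℕ} (V : ⋀[ℝ]^q T) (w : Fin q → Module.Dual ℝ T) :
    evalCovectors V w = exteriorPower.alternatingMapToDual ℝ T q w V := by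
  simp [evalCovectors, exteriorPower.pairingDual]

theorem evalCovectors_ιMulti {q : ℕ} (v : Fin q → T) (w : Fin q → Module.Dual ℝ T) :
    evalCovectors (exteriorPower.ιMulti ℝ q v) w = Matrix.det (.of fun i j => w j (v i)) := by
  simp [evalCovectors]

theorem evalCovectors_add {q : ℕ} (V V' : ⋀[ℝ]^q T) (w : Fin q → Module.Dual ℝ T) :
    evalCovectors (V + V') w = evalCovectors V w + evalCovectors V' w :=
  map_add _ _ _

theorem evalCovectors_smul {q : ℕ} (c : ℝ) (V : ⋀[ℝ]^q T) (w : Fin q → Module.Dual ℝ T) :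
    evalCovectors (c • V) w = c * evalCovectors V w :=
  map_smul _ _ _

theorem evalCovectors_map {q : ℕ} (A : T →ₗ[ℝ] S) (V : ⋀[ℝ]^q T)
    (w : Fin q → Module.Dual ℝ S) :
    evalCovectors (exteriorPower.map q A V) w = evalCovectors V (fun i => w i ∘ₗ A) := by
  have : (exteriorPower.pairingDual ℝ S q (exteriorPower.ιMulti ℝ q w)) ∘ₗ exteriorPower.map q A
      = exteriorPower.pairingDual ℝ T q (exteriorPower.ιMulti ℝ q fun i => w i ∘ₗ A) := by
    apply exteriorPower.linearMap_ext
    ext v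
    simp
  exact LinearMap.congr_fun this V

/-- A `q`-vector is determined by its components with respect to a basis. -/
theorem eq_of_evalCovectors_eq {q n : ℕ} (b : Module.Basis (Fin n) ℝ T) {V V' : ⋀[ℝ]^q T}
    (h : ∀ I : Fin q ↪o Fin n, evalCovectors V (fun k => b.coord (I k))
      = evalCovectors V' (fun k => b.coord (I k))) : V = V' := by
  apply (b.exteriorPower q).repr.injective
  ext s
  rw [exteriorPower.basis_repr_apply, exteriorPower.basis_repr_apply]
  exact h (Set.powersetCard.ofFinEmbEquiv.symm s)

/-- The map `id - w ⊗ v` acts on the exterior algebra by `a ↦ a - v ∧ i_w a`. -/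
theorem exteriorAlgebra_map_sub_smulRight (w : Module.Dual ℝ T) (v : T) (a : ExteriorAlgebra ℝ T) :
    ExteriorAlgebra.map (LinearMap.id - w.smulRight v) a =
      a - ExteriorAlgebra.ι ℝ v * CliffordAlgebra.contractLeft (Q := (0 : QuadraticForm ℝ T)) w a := by
  induction a using CliffordAlgebra.left_induction with
  | algebraMap r =>
    rw [CliffordAlgebra.contractLeft_algebraMap, mul_zero, sub_zero]
    exact AlgHom.commutes _ r
  | add x y hx hy => rw [map_add, map_add, hx, hy, mul_add]; abel
  | ι_mul x m hx =>
    rw [map_mul, hx, CliffordAlgebra.contractLeft_ι_mul]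
    have h1 : ExteriorAlgebra.map (LinearMap.id - w.smulRight v)
        (CliffordAlgebra.ι (0 : QuadraticForm ℝ T) m) =
        ExteriorAlgebra.ι ℝ m - w m • ExteriorAlgebra.ι ℝ v := by
      refine (ExteriorAlgebra.map_apply_ι _ _).trans ?_
      simp
    rw [h1]
    change (ExteriorAlgebra.ι ℝ m - w m • ExteriorAlgebra.ι ℝ v) * _ =
      ExteriorAlgebra.ι ℝ m * _ - ExteriorAlgebra.ι ℝ v * (w m • _ - ExteriorAlgebra.ι ℝ m * _)
    have h2 : ∀ y, ExteriorAlgebra.ι ℝ v * (ExteriorAlgebra.ι ℝ m * y) =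
        - (ExteriorAlgebra.ι ℝ m * (ExteriorAlgebra.ι ℝ v * y)) := by
      intro y
      rw [← mul_assoc, ← mul_assoc, ← neg_mul]
      congr 1
      exact eq_neg_of_add_eq_zero_left (ExteriorAlgebra.ι_add_mul_swap v m)
    have h3 : ∀ y, ExteriorAlgebra.ι ℝ v * (ExteriorAlgebra.ι ℝ v * y) = 0 := by
      intro y
      rw [← mul_assoc, ExteriorAlgebra.ι_sq_zero, zero_mul]
    -- In the product `(m - w(m) v) ∧ (x - v ∧ i_w x)` the quadratic term in `v` vanishes; the rest
    -- is the antiderivation rule for `i_w`.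
    simp only [sub_mul, mul_sub, smul_mul_assoc, mul_smul_comm, h2, h3, smul_zero]
    abel

theorem exteriorPower_map_coe {q : ℕ} (A : T →ₗ[ℝ] S) (V : ⋀[ℝ]^q T) :
    (exteriorPower.map q A V : ExteriorAlgebra ℝ S) = ExteriorAlgebra.map A V := by
  have : (⋀[ℝ]^q S).subtype ∘ₗ exteriorPower.map q A
      = (ExteriorAlgebra.map A).toLinearMap ∘ₗ (⋀[ℝ]^q T).subtype := by
    apply exteriorPower.linearMap_ext
    ext v
    simp
  exact LinearMap.congr_fun this V

theorem mem_annihilator {q : ℕ} {V : ⋀[ℝ]^q T} {w : Module.Dual ℝ T} :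
    w ∈ annihilator V ↔
      CliffordAlgebra.contractLeft (Q := (0 : QuadraticForm ℝ T)) w (V : ExteriorAlgebra ℝ T) = 0 :=
  Iff.rfl

/-- `V(w₁, …, w_q)` vanishes if one of the covectors annihilates `V`. -/
theorem evalCovectors_eq_zero_of_mem_annihilator {q : ℕ} {V : ⋀[ℝ]^q T}
    (w : Fin q → Module.Dual ℝ T) (i : Fin q) (h : w i ∈ annihilator V) :
    evalCovectors V w = 0 := by
  by_cases h0 : w i = 0
  · rw [evalCovectors_eq, AlternatingMap.map_coord_zero _ i h0]; rfl
  obtain ⟨v, hv⟩ : ∃ v, w i v = 1 := by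
    obtain ⟨u, hu⟩ : ∃ u, w i u ≠ 0 := by
      by_contra! hc
      exact h0 (LinearMap.ext hc)
    exact ⟨(w i u)⁻¹ • u, by simp [hu]⟩
  -- As `w i v = 1`, the map `id - w i ⊗ v` is the projection along `v` onto the kernel of `w i`. It
  -- fixes `V` because the contraction vanishes, while it pulls `w i` back to zero.
  have hV : exteriorPower.map q (LinearMap.id - (w i).smulRight v) V = V := by
    apply Subtype.ext
    rw [exteriorPower_map_coe, exteriorAlgebra_map_sub_smulRight, mem_annihilator.1 h, mul_zero,
      sub_zero]
  rw [← hV, evalCovectors_map, evalCovectors_eq, AlternatingMap.map_coord_zero _ i]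
  · rfl
  · ext u
    simp [hv]

/-- Both sides kill scalars and obey the same antiderivation rule on `m ∧ x`, so induction on left
multiplication by vectors suffices. This makes annihilators natural under linear isomorphisms. -/
theorem contractLeft_map (A : T →ₗ[ℝ] S) (w : Module.Dual ℝ S) (a : ExteriorAlgebra ℝ T) :
    CliffordAlgebra.contractLeft (Q := (0 : QuadraticForm ℝ S)) w (ExteriorAlgebra.map A a) =
      ExteriorAlgebra.map A
        (CliffordAlgebra.contractLeft (Q := (0 : QuadraticForm ℝ T)) (w ∘ₗ A) a) := by
  induction a using CliffordAlgebra.left_induction with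
  | algebraMap r =>
    rw [CliffordAlgebra.contractLeft_algebraMap, map_zero]
    have : ExteriorAlgebra.map A (algebraMap ℝ (CliffordAlgebra (0 : QuadraticForm ℝ T)) r)
      = algebraMap ℝ _ r := AlgHom.commutes _ r
    rw [this]
    exact CliffordAlgebra.contractLeft_algebraMap (Q := (0 : QuadraticForm ℝ S)) w r
  | add x y hx hy => rw [map_add, map_add, map_add, map_add, hx, hy]
  | ι_mul x m hx =>
    have h1 : ExteriorAlgebra.map A (CliffordAlgebra.ι (0 : QuadraticForm ℝ T) m)
        = CliffordAlgebra.ι (0 : QuadraticForm ℝ S) (A m) := ExteriorAlgebra.map_apply_ι _ _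
    have h2 := CliffordAlgebra.contractLeft_ι_mul (Q := (0 : QuadraticForm ℝ T)) (w ∘ₗ A) m x
    have h3 := CliffordAlgebra.contractLeft_ι_mul (Q := (0 : QuadraticForm ℝ S)) w (A m)
      (ExteriorAlgebra.map A x)
    rw [map_mul, h1, h2]
    refine h3.trans ?_
    rw [hx]
    have h4 := map_sub (ExteriorAlgebra.map A) ((w ∘ₗ A) m • x)
      (ExteriorAlgebra.ι ℝ m * CliffordAlgebra.contractLeft (Q := (0 : QuadraticForm ℝ T)) (w ∘ₗ A) x)
    rw [map_smul, map_mul, ExteriorAlgebra.map_apply_ι] at h4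
    exact h4.symm

theorem mem_annihilator_map {q : ℕ} (A : T ≃ₗ[ℝ] S) (V : ⋀[ℝ]^q T) (w : Module.Dual ℝ S) :
    w ∈ annihilator (exteriorPower.map q A.toLinearMap V) ↔
      w ∘ₗ A.toLinearMap ∈ annihilator V := by
  rw [mem_annihilator, mem_annihilator, exteriorPower_map_coe, contractLeft_map]
  have : Function.Injective (ExteriorAlgebra.map A.toLinearMap) := 
    ExteriorAlgebra.map_injective_field (LinearMap.ker_eq_bot.2 A.injective)
  exact map_eq_zero_iff _ this

/-- The interior product lowers the degree by one. -/
theorem contractLeft_mem (w : Module.Dual ℝ T) {q : ℕ} {a : ExteriorAlgebra ℝ T}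
    (ha : a ∈ ⋀[ℝ]^(q + 1) T) :
    CliffordAlgebra.contractLeft (Q := (0 : QuadraticForm ℝ T)) w a ∈ ⋀[ℝ]^q T := by
  induction q generalizing a with
  | zero =>
    change a ∈ LinearMap.range (ExteriorAlgebra.ι ℝ : T →ₗ[ℝ] ExteriorAlgebra ℝ T) ^ (0 + 1) at ha
    rw [zero_add, pow_one] at ha
    obtain ⟨v, rfl⟩ := ha
    change CliffordAlgebra.contractLeft w (CliffordAlgebra.ι (0 : QuadraticForm ℝ T) v) ∈
      LinearMap.range (ExteriorAlgebra.ι ℝ : T →ₗ[ℝ] ExteriorAlgebra ℝ T) ^ 0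
    rw [CliffordAlgebra.contractLeft_ι, pow_zero]
    exact Submodule.algebraMap_mem _
  | succ q ih =>
    change a ∈ LinearMap.range (ExteriorAlgebra.ι ℝ : T →ₗ[ℝ] ExteriorAlgebra ℝ T) ^ (q + 1 + 1)
      at ha
    rw [pow_succ'] at ha
    induction ha using Submodule.mul_induction_on' with
    | mem_mul_mem x hx y hy =>
      obtain ⟨v, rfl⟩ := hx
      have : CliffordAlgebra.contractLeft w (CliffordAlgebra.ι (0 : QuadraticForm ℝ T) v * y) ∈
          ⋀[ℝ]^(q + 1) T := by
        rw [CliffordAlgebra.contractLeft_ι_mul]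
        refine Submodule.sub_mem _ (Submodule.smul_mem _ _ hy) ?_
        change _ ∈ LinearMap.range (ExteriorAlgebra.ι ℝ : T →ₗ[ℝ] ExteriorAlgebra ℝ T) ^ (q + 1)
        rw [pow_succ']
        exact Submodule.mul_mem_mul (LinearMap.mem_range_self _ v) (ih hy)
      exact this
    | add x hx y hy h1 h2 => rw [map_add]; exact Submodule.add_mem _ h1 h2

/-- In dimension `m + 1`, every `m`-vector is annihilated by a nonzero covector. -/
theorem annihilator_ne_bot [FiniteDimensional ℝ T] {m : ℕ} (hT : Module.finrank ℝ T = m + 1)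
    (V : ⋀[ℝ]^m T) : annihilator V ≠ ⊥ := by
  have h1 : Module.finrank ℝ (⋀[ℝ]^(m + 1) T) = 1 := by
    rw [exteriorPower.finrank_eq, hT, Nat.choose_self]
  have h2 : Module.finrank ℝ (⋀[ℝ]^(m + 2) T) = 0 := by
    rw [exteriorPower.finrank_eq, hT, Nat.choose_succ_self]
  have h3 : Module.finrank ℝ (⋀[ℝ]^m T) = m + 1 := by
    rw [exteriorPower.finrank_eq, hT]; simp
  obtain ⟨E, hE0, -⟩ := finrank_eq_one_iff'.1 h1
  -- Contraction `w ↦ i_w E` with a generator `E` of the top power.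
  let φ : Module.Dual ℝ T →ₗ[ℝ] ⋀[ℝ]^m T :=
    LinearMap.codRestrict _ ((CliffordAlgebra.contractLeft (Q := (0 : QuadraticForm ℝ T))).flip
      (E : ExteriorAlgebra ℝ T)) fun w => contractLeft_mem w E.2
  have hinj : Function.Injective φ := by
    rw [← LinearMap.ker_eq_bot, LinearMap.ker_eq_bot']
    intro w hw
    ext v
    have hw' : CliffordAlgebra.contractLeft (Q := (0 : QuadraticForm ℝ T)) w
      (E : ExteriorAlgebra ℝ T) = 0 := congrArg Subtype.val hw
    -- The degree `m + 2` exceeds the dimension. Contracting `v ∧ E = 0` with `w`, where `i_w E =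
    -- 0`, leaves `w(v) E = 0`.
    have hz : wedge v E = 0 := by
      have := Module.finrank_zero_iff.1 h2
      exact Subsingleton.elim _ _
    have hz' : CliffordAlgebra.ι (0 : QuadraticForm ℝ T) v * (E : ExteriorAlgebra ℝ T) = 0 :=
      congrArg Subtype.val hz
    have := CliffordAlgebra.contractLeft_ι_mul (Q := (0 : QuadraticForm ℝ T)) w v
      (E : ExteriorAlgebra ℝ T)
    rw [hw', mul_zero, sub_zero, hz', map_zero] at this
    have h := (smul_eq_zero.1 this.symm).resolve_right (fun h => hE0 (Subtype.ext h))
    simpa using h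
  have hsurj : Function.Surjective φ := by
    refine (LinearMap.injective_iff_surjective_of_finrank_eq_finrank ?_).1 hinj
    rw [Subspace.dual_finrank_eq, hT, h3]
  obtain ⟨w, hw⟩ := hsurj V
  -- Since `V = i_w E`, the identity `i_w ∘ i_w = 0` puts `w` in the annihilator. If `w = 0`, then
  -- `V = 0` and every covector annihilates it.
  have hwV : w ∈ annihilator V := by
    rw [mem_annihilator, ← hw]
    exact CliffordAlgebra.contractLeft_contractLeft w _
  intro hbot
  rw [hbot, Submodule.mem_bot] at hwV
  rw [hwV, map_zero] at hw
  have : Module.finrank ℝ (annihilator V) = 0 := by rw [hbot]; simp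
  have htop : annihilator V = ⊤ := by
    rw [eq_top_iff]
    intro u _
    rw [mem_annihilator, ← hw]
    simp
  rw [htop, finrank_top, Subspace.dual_finrank_eq, hT] at this
  omega

end Algebra

end ConstCoeff
end

noncomputable section

namespace ConstCoeff

/-! ### Differentials, vector fields and brackets in a chart; differentials are closed. -/

section Charts

theorem two_le_infty : (2 : ℕ∞ω) ≤ ∞ := WithTop.coe_le_coe.2 (le_top : (2 : ℕ∞) ≤ ⊤)

theorem three_le_infty : (3 : ℕ∞ω) ≤ ∞ := WithTop.coe_le_coe.2 (le_top : (3 : ℕ∞) ≤ ⊤)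

variable {n : ℕ} {M : Type*} [TopologicalSpace M] [ChartedSpace (EuclideanSpace ℝ (Fin n)) M]

/-- The derivative of a chart. -/
def chartDeriv (e : OpenPartialHomeomorph M (EuclideanSpace ℝ (Fin n))) (x : M) :
    TangentSpace (𝓡 n) x →ₗ[ℝ] EuclideanSpace ℝ (Fin n) :=
  (mfderiv (𝓡 n) 𝓘(ℝ, EuclideanSpace ℝ (Fin n)) e x :
    TangentSpace (𝓡 n) x →L[ℝ] EuclideanSpace ℝ (Fin n)).toLinearMap

variable {e : OpenPartialHomeomorph M (EuclideanSpace ℝ (Fin n))}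

theorem mdifferentiable_of_mem (he : e ∈ IsManifold.maximalAtlas (𝓡 n) ∞ M) :
    e.MDifferentiable (𝓡 n) 𝓘(ℝ, EuclideanSpace ℝ (Fin n)) :=
  ⟨(contMDiffOn_of_mem_maximalAtlas he).mdifferentiableOn (by simp),
    (contMDiffOn_symm_of_mem_maximalAtlas he).mdifferentiableOn (by simp)⟩

theorem contDiffOn_comp_symm {F : Type*} [NormedAddCommGroup F] [NormedSpace ℝ F]
    (he : e ∈ IsManifold.maximalAtlas (𝓡 n) ∞ M) {f : M → F} {U : Set M}
    (hf : ContMDiffOn (𝓡 n) 𝓘(ℝ, F) ∞ f U) :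
    ContDiffOn ℝ ∞ (f ∘ e.symm) (e.target ∩ e.symm ⁻¹' U) := by
  rw [← contMDiffOn_iff_contDiffOn]
  exact hf.comp ((contMDiffOn_symm_of_mem_maximalAtlas he).mono Set.inter_subset_left)
    fun _ hz => hz.2

theorem contMDiffOn_comp_chart {F : Type*} [NormedAddCommGroup F] [NormedSpace ℝ F]
    (he : e ∈ IsManifold.maximalAtlas (𝓡 n) ∞ M)
    {g : EuclideanSpace ℝ (Fin n) → F} {s : Set (EuclideanSpace ℝ (Fin n))}
    (hg : ContDiffOn ℝ ∞ g s) :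
    ContMDiffOn (𝓡 n) 𝓘(ℝ, F) ∞ (fun x => g (e x)) (e.source ∩ e ⁻¹' s) :=
  (contMDiffOn_iff_contDiffOn.2 hg).comp
    ((contMDiffOn_of_mem_maximalAtlas he).mono Set.inter_subset_left) fun _ hx => hx.2

theorem differential_congr {f g : M → ℝ} {x : M} (h : f =ᶠ[𝓝 x] g) :
    differential n f x = differential n g x := by
  unfold differential
  congr 1
  exact h.mfderiv_eq

theorem chartDeriv_bijective (he : e ∈ IsManifold.maximalAtlas (𝓡 n) ∞ M) {x : M}
    (hx : x ∈ e.source) : Function.Bijective (chartDeriv e x) :=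
  (mdifferentiable_of_mem he).mfderiv_bijective hx

/-- The derivative of a chart at a point of its domain, as an isomorphism. -/
def chartEquiv (he : e ∈ IsManifold.maximalAtlas (𝓡 n) ∞ M) {x : M}
    (hx : x ∈ e.source) : TangentSpace (𝓡 n) x ≃ₗ[ℝ] EuclideanSpace ℝ (Fin n) :=
  LinearEquiv.ofBijective (chartDeriv e x) (chartDeriv_bijective he hx)

theorem differential_comp_chart (he : e ∈ IsManifold.maximalAtlas (𝓡 n) ∞ M)
    {g : EuclideanSpace ℝ (Fin n) → ℝ} {x : M} (hx : x ∈ e.source)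
    (hg : DifferentiableAt ℝ g (e x)) :
    differential n (fun y => g (e y)) x = (fderiv ℝ g (e x)).toLinearMap ∘ₗ chartDeriv e x := by
  have h := mfderiv_comp (I := 𝓡 n) (I' := 𝓘(ℝ, EuclideanSpace ℝ (Fin n))) (I'' := 𝓘(ℝ, ℝ)) x
    hg.mdifferentiableAt ((mdifferentiable_of_mem he).mdifferentiableAt hx)
  ext v
  have h2 := congrArg (fun A : TangentSpace (𝓡 n) x →L[ℝ] ℝ => A v) h
  rw [mfderiv_eq_fderiv] at h2
  exact h2

theorem differential_eq (he : e ∈ IsManifold.maximalAtlas (𝓡 n) ∞ M)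
    {f : M → ℝ} {U : Set M} (hU : IsOpen U) (hf : SmoothFun n f U) {x : M} (hx : x ∈ e.source)
    (hxU : x ∈ U) :
    differential n f x = (fderiv ℝ (f ∘ e.symm) (e x)).toLinearMap ∘ₗ chartDeriv e x := by
  rw [← differential_comp_chart he hx]
  · apply differential_congr
    filter_upwards [e.open_source.mem_nhds hx] with y hy
    simp [e.left_inv hy]
  · refine (contDiffOn_comp_symm he hf).differentiableOn (by simp) |>.differentiableAt ?_
    exact (e.isOpen_inter_preimage_symm hU).mem_nhds ⟨e.map_source hx, by simpa [e.left_inv hx]⟩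

theorem differential_coord (he : e ∈ IsManifold.maximalAtlas (𝓡 n) ∞ M) {x : M}
    (hx : x ∈ e.source) (k : Fin n) :
    differential n (fun y => e y k) x =
      (EuclideanSpace.basisFun (Fin n) ℝ).toBasis.coord k ∘ₗ chartDeriv e x := by
  have h := differential_comp_chart he hx
    (EuclideanSpace.proj k : EuclideanSpace ℝ (Fin n) →L[ℝ] ℝ).differentiableAt
  rw [ContinuousLinearMap.fderiv] at h
  refine h.trans ?_
  ext v
  simp

theorem smoothFun_clm_comp_chart (he : e ∈ IsManifold.maximalAtlas (𝓡 n) ∞ M)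
    (L : EuclideanSpace ℝ (Fin n) →L[ℝ] ℝ) : SmoothFun n (fun y => L (e y)) e.source := by
  have := contMDiffOn_comp_chart he (L.contDiff (n := ∞)).contDiffOn (s := Set.univ)
  rwa [Set.preimage_univ, Set.inter_univ] at this

theorem smoothFun_coord (he : e ∈ IsManifold.maximalAtlas (𝓡 n) ∞ M) (k : Fin n) :
    SmoothFun n (fun y => e y k) e.source :=
  smoothFun_clm_comp_chart he (EuclideanSpace.proj k)

theorem mfderiv_isInvertible (he : e ∈ IsManifold.maximalAtlas (𝓡 n) ∞ M) {x : M}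
    (hx : x ∈ e.source) :
    (mfderiv (𝓡 n) 𝓘(ℝ, EuclideanSpace ℝ (Fin n)) e x).IsInvertible :=
  ⟨(mdifferentiable_of_mem he).mfderiv hx, rfl⟩

/-- The vector field on the domain of a chart with given representation in the chart. -/
def pullField (e : OpenPartialHomeomorph M (EuclideanSpace ℝ (Fin n)))
    (X : EuclideanSpace ℝ (Fin n) → EuclideanSpace ℝ (Fin n)) : VField n M :=
  VectorField.mpullback (𝓡 n) 𝓘(ℝ, EuclideanSpace ℝ (Fin n)) e X

theorem chartDeriv_pullField (he : e ∈ IsManifold.maximalAtlas (𝓡 n) ∞ M)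
    (X : EuclideanSpace ℝ (Fin n) → EuclideanSpace ℝ (Fin n)) {x : M} (hx : x ∈ e.source) :
    chartDeriv e x (pullField e X x) = X (e x) :=
  (mfderiv_isInvertible he hx).self_apply_inverse _

/-- The representation of a vector field in a chart. -/
def pushField (e : OpenPartialHomeomorph M (EuclideanSpace ℝ (Fin n))) (X : VField n M) :
    EuclideanSpace ℝ (Fin n) → EuclideanSpace ℝ (Fin n) :=
  fun z => chartDeriv e (e.symm z) (X (e.symm z))

theorem pullField_pushField (he : e ∈ IsManifold.maximalAtlas (𝓡 n) ∞ M) (X : VField n M) {x : M}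
    (hx : x ∈ e.source) : pullField e (pushField e X) x = X x := by
  apply (chartDeriv_bijective he hx).1
  rw [chartDeriv_pullField he _ hx, pushField, e.left_inv hx]

variable [IsManifold (𝓡 n) ∞ M]

/-- The derivative of a smooth map along a smooth vector field is smooth. -/
theorem contMDiffOn_mfderiv_apply {F : Type*} [NormedAddCommGroup F] [NormedSpace ℝ F]
    {f : M → F} {U : Set M} (hU : IsOpen U) (hf : ContMDiffOn (𝓡 n) 𝓘(ℝ, F) ∞ f U)
    {X : VField n M} (hX : SmoothVF X U) :
    ContMDiffOn (𝓡 n) 𝓘(ℝ, F) ∞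
      (fun x => (mfderiv (𝓡 n) 𝓘(ℝ, F) f x : TangentSpace (𝓡 n) x →L[ℝ] F) (X x)) U := by
  have h1 := hf.contMDiffOn_tangentMapWithin (m := ∞) (by simp) hU.uniqueMDiffOn
  have h2 := h1.comp hX fun _ hx => hx
  have h3 := contMDiff_snd_tangentBundle_modelSpace F 𝓘(ℝ, F) (n := ∞) |>.comp_contMDiffOn h2
  refine h3.congr fun x hx => ?_
  change _ = mfderivWithin (𝓡 n) 𝓘(ℝ, F) f U x (X x)
  rw [mfderivWithin_of_isOpen hU hx]

theorem smoothFun_lieDer {f : M → ℝ} {U : Set M} (hU : IsOpen U) (hf : SmoothFun n f U)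
    {X : VField n M} (hX : SmoothVF X U) : SmoothFun n (lieDer X f) U :=
  contMDiffOn_mfderiv_apply hU hf hX

theorem smoothVF_pullField (he : e ∈ IsManifold.maximalAtlas (𝓡 n) ∞ M)
    {X : EuclideanSpace ℝ (Fin n) → EuclideanSpace ℝ (Fin n)}
    {s : Set (EuclideanSpace ℝ (Fin n))} (hX : ContDiffOn ℝ ∞ X s) :
    SmoothVF (pullField e X) (e.source ∩ e ⁻¹' s) := by
  intro x hx
  refine (ContMDiffWithinAt.mpullback_vectorField_preimage (t := s) (n := ∞)
    (contMDiffWithinAt_vectorSpace_iff_contDiffWithinAt.2 (hX _ hx.2))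
    (contMDiffAt_of_mem_maximalAtlas he hx.1) (mfderiv_isInvertible he hx.1) (by simp)).mono
    Set.inter_subset_right

theorem contDiffOn_pushField (he : e ∈ IsManifold.maximalAtlas (𝓡 n) ∞ M) {X : VField n M}
    {U : Set M} (hU : IsOpen U) (hX : SmoothVF X U) :
    ContDiffOn ℝ ∞ (pushField e X) (e.target ∩ e.symm ⁻¹' U) := by
  have h := contDiffOn_comp_symm he (contMDiffOn_mfderiv_apply (e.open_source.inter hU)
    ((contMDiffOn_of_mem_maximalAtlas he).mono Set.inter_subset_left)
    (hX.mono Set.inter_subset_right))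
  refine h.mono fun z hz => ⟨hz.1, e.map_target hz.1, hz.2⟩

/-- Near `x` each field is the pullback of its chart representation, and brackets commute with
pullback; on the model space the manifold bracket is the ordinary one. -/
theorem chartDeriv_mlieBracket (he : e ∈ IsManifold.maximalAtlas (𝓡 n) ∞ M) {X Y : VField n M}
    {U : Set M} (hU : IsOpen U) (hX : SmoothVF X U) (hY : SmoothVF Y U) {x : M}
    (hx : x ∈ e.source) (hxU : x ∈ U) :
    chartDeriv e x (VectorField.mlieBracket (𝓡 n) X Y x) =
      VectorField.lieBracket ℝ (pushField e X) (pushField e Y) (e x) := by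
  have hm : e.target ∩ e.symm ⁻¹' U ∈ 𝓝 (e x) :=
    (e.isOpen_inter_preimage_symm hU).mem_nhds ⟨e.map_source hx, by simpa [e.left_inv hx]⟩
  have hd : ∀ Z : VField n M, SmoothVF Z U → MDifferentiableAt 𝓘(ℝ, EuclideanSpace ℝ (Fin n))
      𝓘(ℝ, EuclideanSpace ℝ (Fin n)).tangent (fun z => (⟨z, pushField e Z z⟩ :
        TangentBundle 𝓘(ℝ, EuclideanSpace ℝ (Fin n)) (EuclideanSpace ℝ (Fin n)))) (e x) := by
    intro Z hZ
    have := (contDiffOn_pushField he hU hZ).contDiffAt hm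
    exact (contMDiffAt_vectorSpace_iff_contDiffAt.2 this).mdifferentiableAt (by simp)
  have hc : ∀ Z : VField n M, Z =ᶠ[𝓝 x] pullField e (pushField e Z) := by
    intro Z
    filter_upwards [e.open_source.mem_nhds hx] with y hy
    rw [pullField_pushField he _ hy]
  have : IsManifold (𝓡 n) (minSmoothness ℝ 3) M :=
    IsManifold.of_le (n := ∞) (by simpa using three_le_infty)
  have h := VectorField.mpullback_mlieBracket (hd X hX) (hd Y hY)
    (contMDiffAt_of_mem_maximalAtlas he hx) (by simpa using two_le_infty)
  rw [(hc X).mlieBracket_vectorField_eq (hc Y)]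
  unfold pullField
  rw [← h]
  have h2 := VectorField.mlieBracketWithin_eq_lieBracketWithin (𝕜 := ℝ) (V := pushField e X)
    (W := pushField e Y) (s := Set.univ)
  rw [VectorField.lieBracketWithin_univ] at h2
  exact ((mfderiv_isInvertible he hx).self_apply_inverse _).trans (congrFun h2 _)

/-- Differentials are closed. -/
theorem closedForm_differential {f : M → ℝ} {U : Set M} (hf : SmoothFun n f U) :
    ClosedForm (differential n f) U := by
  intro W hW hWU X Y hX hY x hx
  set e := chartAt (EuclideanSpace ℝ (Fin n)) x with hedef
  have he : e ∈ IsManifold.maximalAtlas (𝓡 n) ∞ M := IsManifold.chart_mem_maximalAtlas x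
  have hxe : x ∈ e.source := mem_chart_source _ x
  have hfW := hf.mono hWU
  set g := f ∘ e.symm with hg
  set s := e.target ∩ e.symm ⁻¹' W with hs
  have hso : IsOpen s := e.isOpen_inter_preimage_symm hW
  have hxs : e x ∈ s := ⟨e.map_source hxe, by simpa [e.left_inv hxe]⟩
  have hgs : ContDiffOn ℝ ∞ g s := contDiffOn_comp_symm he hfW
  have key : ∀ Z : VField n M, ∀ y ∈ e.source ∩ W,
      lieDer Z f y = fderiv ℝ g (e y) (pushField e Z (e y)) := by
    intro Z y hy
    rw [lieDer, differential_eq he hW hfW hy.1 hy.2, pushField, e.left_inv hy.1]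
    rfl
  have key2 : ∀ Z Z' : VField n M, SmoothVF Z W → SmoothVF Z' W → lieDer Z (lieDer Z' f) x =
      fderiv ℝ (fun z => fderiv ℝ g z (pushField e Z' z)) (e x) (pushField e Z (e x)) := by
    intro Z Z' hZ hZ'
    rw [lieDer, differential_eq he hW (smoothFun_lieDer hW hfW hZ') hxe hx, pushField,
      e.left_inv hxe]
    have : (lieDer Z' f ∘ e.symm) =ᶠ[𝓝 (e x)] fun z => fderiv ℝ g z (pushField e Z' z) := by
      filter_upwards [hso.mem_nhds hxs] with z hz
      rw [Function.comp_apply, key Z' _ ⟨e.map_target hz.1, hz.2⟩, e.right_inv hz.1]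
    rw [this.fderiv_eq]
    rfl
  have hdg : DifferentiableAt ℝ (fderiv ℝ g) (e x) :=
    ((hgs.fderiv_of_isOpen hso (m := ∞) (by simp)).contDiffAt (hso.mem_nhds hxs)).differentiableAt
      (by simp)
  have hdp : ∀ Z : VField n M, SmoothVF Z W → DifferentiableAt ℝ (pushField e Z) (e x) :=
    fun Z hZ => ((contDiffOn_pushField he hW hZ).contDiffAt (hso.mem_nhds hxs)).differentiableAt
      (by simp)
  have hsymm : IsSymmSndFDerivAt ℝ g (e x) :=
    (hgs.contDiffAt (hso.mem_nhds hxs)).isSymmSndFDerivAt (by simpa using two_le_infty)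
  change lieDer X (lieDer Y f) x - lieDer Y (lieDer X f) x - _ = 0
  rw [key2 X Y hX hY, key2 Y X hY hX, differential_eq he hW hfW hxe hx, LinearMap.comp_apply,
    chartDeriv_mlieBracket he hW hX hY hxe hx, fderiv_clm_apply hdg (hdp Y hY),
    fderiv_clm_apply hdg (hdp X hX), VectorField.lieBracket]
  -- The second derivatives of `g` cancel by symmetry; what remains is `dg` applied to the bracket
  -- formula.
  have := hsymm.eq (pushField e X (e x)) (pushField e Y (e x))
  simp [this, ← hg]

end Charts

end ConstCoeff
end

noncomputable section

namespace ConstCoeff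

/-! ### From constant coefficients to the two conditions. -/

section Algebra

variable {T : Type*} [AddCommGroup T] [Module ℝ T]
variable {S : Type*} [AddCommGroup S] [Module ℝ S]

theorem wedge_add {q : ℕ} (v v' : T) (V : ⋀[ℝ]^q T) : wedge (v + v') V = wedge v V + wedge v' V :=
  Subtype.ext (by simp [wedge, add_mul])

theorem wedge_smul {q : ℕ} (c : ℝ) (v : T) (V : ⋀[ℝ]^q T) : wedge (c • v) V = c • wedge v V :=
  Subtype.ext (by simp [wedge])

/-- With `v` the parallel frame, this turns the closedness identity of a scalar form into flatness
or into `d^∇ η = 0`. -/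
theorem smul_sub_smul_sub_smul {a b c : ℝ} (v : T) (h : a - b - c = 0) :
    a • v - b • v - c • v = 0 := by
  rw [← sub_smul, ← sub_smul, h, zero_smul]

theorem exists_frame [FiniteDimensional ℝ T] (P : Submodule ℝ T) :
    ∃ (k : ℕ) (b : Fin k → T),
      LinearIndependent ℝ b ∧ Submodule.span ℝ (Set.range b) = P := by
  let b := Module.finBasis ℝ P
  refine ⟨_, P.subtype ∘ b, b.linearIndependent.map' _ (Submodule.ker_subtype _), ?_⟩
  rw [Set.range_comp, Submodule.span_image, b.span_eq, Submodule.map_top, Submodule.range_subtype]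

theorem frame_comp (A : T ≃ₗ[ℝ] S) {P : Submodule ℝ (Module.Dual ℝ S)} {k : ℕ}
    {b : Fin k → Module.Dual ℝ S} (hb : LinearIndependent ℝ b)
    (hP : Submodule.span ℝ (Set.range b) = P) :
    LinearIndependent ℝ (fun j => b j ∘ₗ A.toLinearMap) ∧
      Submodule.span ℝ (Set.range fun j => b j ∘ₗ A.toLinearMap) =
        P.map A.dualMap.toLinearMap := by
  refine ⟨hb.map' A.dualMap.toLinearMap (LinearEquiv.ker _), ?_⟩
  rw [← hP, ← Submodule.span_image, ← Set.range_comp]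
  rfl

theorem map_wedge {q : ℕ} (A : T →ₗ[ℝ] S) (v : T) (V : ⋀[ℝ]^q T) :
    exteriorPower.map (q + 1) A (wedge v V) = wedge (A v) (exteriorPower.map q A V) := by
  apply Subtype.ext
  rw [exteriorPower_map_coe]
  simp [wedge, exteriorPower_map_coe]

end Algebra

variable {n : ℕ} {M : Type*} [TopologicalSpace M] [ChartedSpace (EuclideanSpace ℝ (Fin n)) M]
  {e : OpenPartialHomeomorph M (EuclideanSpace ℝ (Fin n))}

theorem differential_clm_comp_chart (he : e ∈ IsManifold.maximalAtlas (𝓡 n) ∞ M)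
    (L : EuclideanSpace ℝ (Fin n) →ₗ[ℝ] ℝ) {x : M} (hx : x ∈ e.source) :
    differential n (fun y => L (e y)) x = L ∘ₗ chartDeriv e x := by
  have h := differential_comp_chart he hx (LinearMap.toContinuousLinearMap L).differentiableAt
  rw [ContinuousLinearMap.fderiv] at h
  exact h

theorem smoothFun_linear_comp_chart (he : e ∈ IsManifold.maximalAtlas (𝓡 n) ∞ M)
    (L : EuclideanSpace ℝ (Fin n) →ₗ[ℝ] ℝ) : SmoothFun n (fun y => L (e y)) e.source :=
  smoothFun_clm_comp_chart he (LinearMap.toContinuousLinearMap L)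

/-- The coordinate frame at a point of the domain of a chart. -/
def chartBasis (he : e ∈ IsManifold.maximalAtlas (𝓡 n) ∞ M) {x : M} (hx : x ∈ e.source) :
    Module.Basis (Fin n) ℝ (TangentSpace (𝓡 n) x) :=
  (EuclideanSpace.basisFun (Fin n) ℝ).toBasis.map (chartEquiv he hx).symm

theorem chartBasis_coord (he : e ∈ IsManifold.maximalAtlas (𝓡 n) ∞ M) {x : M}
    (hx : x ∈ e.source) (k : Fin n) :
    (chartBasis he hx).coord k = differential n (fun y => e y k) x := by
  rw [differential_coord he hx]
  ext v
  simp [chartBasis, chartEquiv]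

/-- A multivector field with constant coefficients is constant in the chart. -/
theorem exists_map_chartDeriv_eq {q : ℕ} {V : MVField n M q}
    (he : e ∈ IsManifold.maximalAtlas (𝓡 n) ∞ M)
    (hV : ∀ I : Fin q ↪o Fin n, ∃ c : ℝ, ∀ x ∈ e.source,
      evalCovectors (V x) (fun k => differential n (fun y => e y (I k)) x) = c)
    {x₀ : M} (hx₀ : x₀ ∈ e.source) :
    ∀ x ∈ e.source, exteriorPower.map q (chartDeriv e x) (V x) =
      exteriorPower.map q (chartDeriv e x₀) (V x₀) := by
  intro x hx
  apply eq_of_evalCovectors_eq (EuclideanSpace.basisFun (Fin n) ℝ).toBasis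
  intro I
  obtain ⟨c, hc⟩ := hV I
  have h1 := hc x hx
  have h2 := hc x₀ hx₀
  simp only [differential_coord he hx] at h1
  simp only [differential_coord he hx₀] at h2
  rw [evalCovectors_map, evalCovectors_map, h1, h2]

/-- When the chart value `V₀` is constant, this exhibits the Pfaffian system as one fixed space of
covectors carried to each point by the chart. -/
theorem pfaffian_eq_map {q : ℕ} {V : MVField n M q}
    (he : e ∈ IsManifold.maximalAtlas (𝓡 n) ∞ M) {x : M} (hx : x ∈ e.source)
    {V₀ : ⋀[ℝ]^q (EuclideanSpace ℝ (Fin n))}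
    (hV₀ : exteriorPower.map q (chartDeriv e x) (V x) = V₀) :
    pfaffian V x = (annihilator V₀).map (chartEquiv he hx).dualMap.toLinearMap := by
  have h : ∀ w, w ∈ annihilator V₀ ↔ w ∘ₗ (chartEquiv he hx).toLinearMap ∈ annihilator (V x) := by
    intro w
    rw [← mem_annihilator_map, ← hV₀]
    rfl
  ext w
  constructor
  · intro hw
    have hw' : (chartEquiv he hx).symm.dualMap w ∘ₗ (chartEquiv he hx).toLinearMap = w := by
      refine LinearMap.ext fun v => ?_
      change w ((chartEquiv he hx).symm ((chartEquiv he hx) v)) = w v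
      rw [LinearEquiv.symm_apply_apply]
    refine ⟨(chartEquiv he hx).symm.dualMap w, ?_, hw'⟩
    rw [SetLike.mem_coe, h, hw']
    exact hw
  · rintro ⟨w, hw, rfl⟩
    exact (h w).1 hw

/-- The frame `∂₁ ∧ ⋯ ∧ ∂ₙ` of a chart. -/
def volField (e : OpenPartialHomeomorph M (EuclideanSpace ℝ (Fin n))) : MVField n M n :=
  fun x => exteriorPower.ιMulti ℝ n
    fun i => pullField e (fun _ => EuclideanSpace.basisFun (Fin n) ℝ i) x

/-- The component of an `n`-vector field with respect to a chart. -/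
def volComponent (e : OpenPartialHomeomorph M (EuclideanSpace ℝ (Fin n))) (W : MVField n M n) :
    M → ℝ :=
  fun x => evalCovectors (W x) fun i => differential n (fun y => e y i) x

theorem volComponent_volField (he : e ∈ IsManifold.maximalAtlas (𝓡 n) ∞ M) {x : M}
    (hx : x ∈ e.source) : volComponent e (volField e) x = 1 := by
  rw [volComponent, volField, evalCovectors_ιMulti, ← Matrix.det_one (n := Fin n)]
  congr 1
  ext i j
  rw [Matrix.of_apply, differential_coord he hx, LinearMap.comp_apply,
    chartDeriv_pullField he _ hx]
  simp [Matrix.one_apply, eq_comm]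

theorem eq_volComponent_smul (he : e ∈ IsManifold.maximalAtlas (𝓡 n) ∞ M) {x : M}
    (hx : x ∈ e.source) (W : MVField n M n) : W x = volComponent e W x • volField e x := by
  apply eq_of_evalCovectors_eq (chartBasis he hx)
  intro I
  -- The only order embedding of `Fin n` in itself is the identity, so a top-degree multivector has
  -- one component.
  have hI : ∀ k, I k = k := by
    have : I = RelEmbedding.refl _ := by
      refine RelEmbedding.ext fun k =>
        congrFun ((StrictMono.range_inj I.strictMono strictMono_id).1 ?_) k
      rw [(Finite.surjective_of_injective I.injective).range_eq, Set.range_id]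
    intro k
    rw [this]
    rfl
  simp only [chartBasis_coord, hI]
  rw [evalCovectors_smul]
  change _ = _ * volComponent e (volField e) x
  rw [volComponent_volField he hx, mul_one]
  rfl

theorem smoothFun_volComponent (he : e ∈ IsManifold.maximalAtlas (𝓡 n) ∞ M) {W : MVField n M n}
    (hW : SmoothMV W e.source) : SmoothFun n (volComponent e W) e.source :=
  hW _ e.open_source subset_rfl _ fun i => smoothFun_coord he i

theorem lieDer_congr {f g : M → ℝ} {U : Set M} (hU : IsOpen U) (h : ∀ x ∈ U, f x = g x)
    {X Y : VField n M} {x : M} (hXY : X x = Y x) (hx : x ∈ U) : lieDer X f x = lieDer Y g x := by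
  have : f =ᶠ[𝓝 x] g := by filter_upwards [hU.mem_nhds hx] with y hy using h y hy
  rw [lieDer, lieDer, differential_congr this, hXY]

theorem SmoothFun.mdifferentiableAt {f : M → ℝ} {U : Set M} (hU : IsOpen U) (hf : SmoothFun n f U)
    {x : M} (hx : x ∈ U) : MDifferentiableAt (𝓡 n) 𝓘(ℝ, ℝ) f x :=
  ((hf x hx).contMDiffAt (hU.mem_nhds hx)).mdifferentiableAt (by simp)

theorem differential_eq_zero {f : M → ℝ} {U : Set M} (hU : IsOpen U) (hf : ∀ x ∈ U, f x = 0)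
    {x : M} (hx : x ∈ U) : differential n f x = 0 := by
  have : f =ᶠ[𝓝 x] fun _ => 0 := by filter_upwards [hU.mem_nhds hx] with y hy using hf y hy
  rw [differential_congr this]
  ext v
  simp [differential, mfderiv_const]
  rfl

theorem lieDer_add {f g : M → ℝ} {U : Set M} (hU : IsOpen U) (hf : SmoothFun n f U)
    (hg : SmoothFun n g U) (X : VField n M) {x : M} (hx : x ∈ U) :
    lieDer X (f + g) x = lieDer X f x + lieDer X g x := by
  have := mfderiv_add (hf.mdifferentiableAt hU hx) (hg.mdifferentiableAt hU hx)
  exact congrArg (fun A : TangentSpace (𝓡 n) x →L[ℝ] ℝ => A (X x)) this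

theorem lieDer_mul {f g : M → ℝ} {U : Set M} (hU : IsOpen U) (hf : SmoothFun n f U)
    (hg : SmoothFun n g U) (X : VField n M) {x : M} (hx : x ∈ U) :
    lieDer X (f * g) x = lieDer X f x * g x + f x * lieDer X g x := by
  have := ((hf.mdifferentiableAt hU hx).hasMFDerivAt.mul
    (hg.mdifferentiableAt hU hx).hasMFDerivAt).mfderiv
  have := congrArg (fun A : TangentSpace (𝓡 n) x →L[ℝ] ℝ => A (X x)) this
  refine this.trans ?_
  change f x * _ + g x * _ = _
  rw [add_comm, mul_comm (g x)]
  rfl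

variable [IsManifold (𝓡 n) ∞ M]

theorem smoothForm_differential {f : M → ℝ} {U : Set M} (hf : SmoothFun n f U) :
    SmoothForm (differential n f) U :=
  fun _ hW hWU _ hX => smoothFun_lieDer hW (hf.mono hWU) hX

/-- Multivector fields with constant coefficients have a Pfaffian system of constant rank with
closed frames, which is integrable. -/
theorem pfaffian_of_constant {q : ℕ} {V : MVField n M q}
    (he : e ∈ IsManifold.maximalAtlas (𝓡 n) ∞ M) {V₀ : ⋀[ℝ]^q (EuclideanSpace ℝ (Fin n))}
    (hV₀ : ∀ x ∈ e.source, exteriorPower.map q (chartDeriv e x) (V x) = V₀) :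
    LocallyConstantRank (pfaffian V) e.source ∧ HasLocalClosedBases (pfaffian V) e.source ∧
      IsIntegrable (pfaffian V) e.source := by
  have hP := fun x (hx : x ∈ e.source) => pfaffian_eq_map he hx (hV₀ x hx)
  refine ⟨?_, ?_, ?_⟩
  · intro x hx
    filter_upwards [e.open_source.mem_nhds hx] with y hy
    rw [hP x hx, hP y hy, LinearEquiv.finrank_map_eq, LinearEquiv.finrank_map_eq]
  · intro x hx
    obtain ⟨k, b, hb, hbP⟩ := exists_frame (annihilator V₀)
    refine ⟨e.source, e.open_source, hx, subset_rfl, k,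
      fun j => differential n fun y => b j (e y), fun j => ?_, fun y hy => ?_⟩
    · have := smoothFun_linear_comp_chart he (b j)
      exact ⟨smoothForm_differential this, closedForm_differential this⟩
    · have hd : (fun j => differential n (fun y => b j (e y)) y) =
          fun j => b j ∘ₗ (chartEquiv he hy).toLinearMap :=
        funext fun j => differential_clm_comp_chart he _ hy
      rw [hd, hP y hy]
      exact frame_comp _ hb hbP
  · intro W hW hWU X Y hX hY hPX hPY x hx w hw
    rw [hP x (hWU hx)] at hw
    obtain ⟨w, hw, rfl⟩ := hw
    -- A covector of the system at one point extends to an exact section, with constant coefficients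
    -- in the chart. Its closedness, evaluated on fields it annihilates, leaves only the bracket
    -- term.
    have hmem : ∀ y ∈ W, differential n (fun y => w (e y)) y ∈ pfaffian V y := by
      intro y hy
      rw [hP y (hWU hy), differential_clm_comp_chart he w (hWU hy)]
      exact ⟨w, hw, rfl⟩
    have hc := closedForm_differential (smoothFun_linear_comp_chart he w) W hW hWU X Y hX hY x hx
    rw [lieDer, lieDer, differential_eq_zero hW (fun y hy => hPY y hy _ (hmem y hy)) hx,
      differential_eq_zero hW (fun y hy => hPX y hy _ (hmem y hy)) hx,
      differential_clm_comp_chart he w (hWU hx)] at hc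
    have h0 : ∀ Z : VField n M, (0 : Module.Dual ℝ (TangentSpace (𝓡 n) x)) (Z x) = 0 := fun _ => rfl
    rw [h0, h0, sub_zero, zero_sub, neg_eq_zero] at hc
    exact hc

theorem smoothMV_volField (he : e ∈ IsManifold.maximalAtlas (𝓡 n) ∞ M) :
    SmoothMV (volField e) e.source := by
  intro W hW hWU f hf
  simp only [volField, evalCovectors_ιMulti, Matrix.det_apply', Matrix.of_apply]
  refine contMDiffOn_finsetSum fun σ _ => contMDiffOn_const.mul (contMDiffOn_finsetProd ?_)
  intro i _
  have h := smoothVF_pullField he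
    (contDiff_const (c := EuclideanSpace.basisFun (Fin n) ℝ (σ i)) (n := ∞)).contDiffOn
    (s := Set.univ)
  rw [Set.preimage_univ, Set.inter_univ] at h
  exact smoothFun_lieDer hW (hf i) (h.mono hWU)

/-- The derivation law on `∧ⁿTM` for which `∂₁ ∧ ⋯ ∧ ∂ₙ` is parallel. -/
def chartLaw (he : e ∈ IsManifold.maximalAtlas (𝓡 n) ∞ M) : DerivationLaw n M n e.source where
  toFun X W x := lieDer X (volComponent e W) x • volField e x
  congr X X' W W' hX hW hXX' hWW' x hx := by
    rw [lieDer_congr e.open_source (fun y hy => ?_) (hXX' x hx) hx]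
    rw [volComponent, hWW' y hy, volComponent]
  smooth X W hX hW U hU hUe f hf := by
    have h1 := (smoothFun_lieDer e.open_source (smoothFun_volComponent he hW) hX).mono hUe
    have h2 := smoothMV_volField he U hU hUe f hf
    simp only [evalCovectors_smul]
    exact ContMDiffOn.mul h1 h2
  add_left X Y W hX hY hW x hx := by
    rw [← add_smul]
    congr 1
    exact map_add _ _ _
  smul_left f X W hf hX hW x hx := by
    rw [smul_smul]
    congr 1
    exact map_smul _ _ _
  add_right X W W' hX hW hW' x hx := by
    rw [← add_smul, ← lieDer_add e.open_source (smoothFun_volComponent he hW)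
      (smoothFun_volComponent he hW') X hx]
    congr 2
    ext y
    exact evalCovectors_add _ _ _
  leibniz f X W hf hX hW x hx := by
    have h : volComponent e (fun y => f y • W y) = f * volComponent e W := by
      ext y
      exact evalCovectors_smul _ _ _
    rw [h, lieDer_mul e.open_source hf (smoothFun_volComponent he hW) X hx, add_smul, mul_smul,
      mul_smul, ← eq_volComponent_smul he hx W]

theorem volComponent_chartLaw (he : e ∈ IsManifold.maximalAtlas (𝓡 n) ∞ M) (X : VField n M)
    (W : MVField n M n) {x : M} (hx : x ∈ e.source) :
    volComponent e ((chartLaw he).toFun X W) x = lieDer X (volComponent e W) x := by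
  change evalCovectors (_ • volField e x) _ = _
  rw [evalCovectors_smul]
  change _ * volComponent e (volField e) x = _
  rw [volComponent_volField he hx, mul_one]

/-- If `c` is the component of `W`, the curvature applied to `W` is `d(dc)(X, Y)` times the parallel
frame. -/
theorem isFlat_chartLaw (he : e ∈ IsManifold.maximalAtlas (𝓡 n) ∞ M) : (chartLaw he).IsFlat := by
  intro X Y W hX hY hW x hx
  have hc := closedForm_differential (smoothFun_volComponent he hW) e.source e.open_source
    subset_rfl X Y hX hY x hx
  change lieDer X (volComponent e ((chartLaw he).toFun Y W)) x • volField e x -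
    lieDer Y (volComponent e ((chartLaw he).toFun X W)) x • volField e x -
    differential n (volComponent e W) x _ • volField e x = 0
  rw [lieDer_congr e.open_source (fun y hy => volComponent_chartLaw he Y W hy) rfl hx,
    lieDer_congr e.open_source (fun y hy => volComponent_chartLaw he X W hy) rfl hx]
  exact smul_sub_smul_sub_smul (volField e x) hc

end ConstCoeff

namespace ConstCoeff

variable {m : ℕ} {M : Type*} [TopologicalSpace M]
  [ChartedSpace (EuclideanSpace ℝ (Fin (m + 1))) M] [IsManifold (𝓡 (m + 1)) ∞ M]
  {e : OpenPartialHomeomorph M (EuclideanSpace ℝ (Fin (m + 1)))}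

/-- The component of `v ∧ V₀` is a fixed linear form `L` in `v`, so `η` is the closed form `d(L ∘
e)` times a parallel frame. -/
theorem extCovDeriv_chartLaw (he : e ∈ IsManifold.maximalAtlas (𝓡 (m + 1)) ∞ M)
    {V : MVField (m + 1) M m} {V₀ : ⋀[ℝ]^m (EuclideanSpace ℝ (Fin (m + 1)))}
    (hV₀ : ∀ x ∈ e.source, exteriorPower.map m (chartDeriv e x) (V x) = V₀)
    {X Y : VField (m + 1) M} (hX : SmoothVF X e.source) (hY : SmoothVF Y e.source)
    {x : M} (hx : x ∈ e.source) : (chartLaw he).extCovDeriv (wedgeForm V) X Y x = 0 := by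
  let L : EuclideanSpace ℝ (Fin (m + 1)) →ₗ[ℝ] ℝ :=
    { toFun := fun v => evalCovectors (wedge v V₀)
        fun i => (EuclideanSpace.basisFun (Fin (m + 1)) ℝ).toBasis.coord i
      map_add' := fun v v' => by rw [wedge_add, evalCovectors_add]
      map_smul' := fun c v => by rw [wedge_smul, evalCovectors_smul]; rfl }
  have hL : ∀ (Z : VField (m + 1) M), ∀ y ∈ e.source, volComponent e (wedgeForm V Z) y =
      differential (m + 1) (fun y => L (e y)) y (Z y) := by
    intro Z y hy
    rw [differential_clm_comp_chart he L hy]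
    change _ = evalCovectors (wedge (chartDeriv e y (Z y)) V₀) _
    rw [← hV₀ y hy, ← map_wedge, evalCovectors_map]
    simp only [volComponent, differential_coord he hy]
    rfl
  have hc := closedForm_differential (smoothFun_linear_comp_chart he L) e.source e.open_source
    subset_rfl X Y hX hY x hx
  change lieDer X (volComponent e (wedgeForm V Y)) x • volField e x -
    lieDer Y (volComponent e (wedgeForm V X)) x • volField e x -
    wedgeForm V (VectorField.mlieBracket (𝓡 (m + 1)) X Y) x = 0
  rw [lieDer_congr e.open_source (hL Y) rfl hx, lieDer_congr e.open_source (hL X) rfl hx,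
    eq_volComponent_smul he hx (wedgeForm V _), hL _ x hx]
  exact smul_sub_smul_sub_smul (volField e x) hc

end ConstCoeff
end

noncomputable section

namespace ConstCoeff

/-! ### Smooth primitives in one direction. -/

section PartialPrimitive

variable {E : Type*} [NormedAddCommGroup E] [NormedSpace ℝ E] [FiniteDimensional ℝ E]

/-- Smooth functions can be extended from a neighbourhood of a point, with compact support. -/
theorem exists_compactSupport_extension {f : E → ℝ} {s : Set E} (hs : IsOpen s) {z₀ : E}
    (hz₀ : z₀ ∈ s) (hf : ContDiffOn ℝ ∞ f s) :
    ∃ F : E → ℝ, ContDiff ℝ ∞ F ∧ HasCompactSupport F ∧ F =ᶠ[𝓝 z₀] f := by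
  obtain ⟨r, hr, hrs⟩ := Metric.isOpen_iff.1 hs z₀ hz₀
  let φ : ContDiffBump z₀ := ⟨r / 4, r / 2, by positivity, by linarith⟩
  have hsupp : tsupport (fun z => φ z * f z) ⊆ Metric.closedBall z₀ (r / 2) :=
    (tsupport_mul_subset_left).trans φ.tsupport_eq.subset
  refine ⟨fun z => φ z * f z, ?_, ?_, ?_⟩
  · rw [contDiff_iff_contDiffAt]
    intro z
    by_cases hz : z ∈ s
    · exact φ.contDiff.contDiffAt.mul (hf.contDiffAt (hs.mem_nhds hz))
    · have hz' : z ∉ tsupport (fun z => φ z * f z) := fun h =>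
        hz (hrs (Metric.closedBall_subset_ball (by linarith) (hsupp h)))
      have : (fun z => φ z * f z) =ᶠ[𝓝 z] fun _ => 0 := notMem_tsupport_iff_eventuallyEq.1 hz'
      exact contDiffAt_const.congr_of_eventuallyEq this
  · exact HasCompactSupport.of_support_subset_isCompact (isCompact_closedBall z₀ (r / 2))
      (subset_tsupport _ |>.trans hsupp)
  · filter_upwards [φ.eventuallyEq_one] with z hz
    simp [hz]

open MeasureTheory Convolution in
/-- A smooth function has, near any point, a smooth primitive in a given direction. -/
theorem exists_partial_primitive {f : E → ℝ} {s : Set E} (hs : IsOpen s) {z₀ : E}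
    (hz₀ : z₀ ∈ s) (hf : ContDiffOn ℝ ∞ f s) {v : E} (hv : v ≠ 0) :
    ∃ (G : E → ℝ) (t : Set E), IsOpen t ∧ z₀ ∈ t ∧ ContDiffOn ℝ ∞ G t ∧
      ∀ z ∈ t, fderiv ℝ G z v = f z := by
  obtain ⟨F, hF, hFc, hFf⟩ := exists_compactSupport_extension hs hz₀ hf
  obtain ⟨t, ht, hto, hzt⟩ := eventually_nhds_iff.1 hFf
  obtain ⟨R, hR⟩ := hFc.isCompact.isBounded.subset_closedBall 0
  set B : Set E := Metric.ball z₀ 1 with hB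
  -- For `p` in the unit ball at `z₀` and `τ` beyond this radius, `p + τ v` has norm greater than
  -- `R`, hence lies off the support of `F`.
  set k : Set ℝ := Metric.closedBall 0 ((R + ‖z₀‖ + 1) / ‖v‖) with hk
  have hv0 : 0 < ‖v‖ := norm_pos_iff.2 hv
  let g : E → ℝ → ℝ := fun p τ => F (p + τ • v)
  have hgs : ∀ p τ, p ∈ B → τ ∉ k → g p τ = 0 := by
    intro p τ hp hτ
    by_contra h
    apply hτ
    have h1 : ‖p + τ • v‖ ≤ R := by simpa using hR (subset_tsupport _ h)
    have h2 : ‖p‖ ≤ ‖z₀‖ + 1 := by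
      have := norm_sub_norm_le p z₀
      rw [hB, mem_ball_iff_norm] at hp
      linarith
    have h3 : ‖τ • v‖ ≤ ‖p + τ • v‖ + ‖p‖ := by
      simpa using norm_sub_le (p + τ • v) p
    rw [norm_smul] at h3
    rw [hk, mem_closedBall_zero_iff, le_div_iff₀ hv0]
    linarith
  -- Convolving with the Heaviside function gives `G(p) = ∫_{τ > 0} F(p - τ v) dτ`; as a convolution
  -- with parameter `p`, it is smooth in `p`.
  let H : ℝ → ℝ := Set.indicator (Set.Ioi 0) 1
  have hH : LocallyIntegrable H volume :=
    (locallyIntegrable_const 1).indicator measurableSet_Ioi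
  have hgd : ContDiff ℝ ∞ (Function.uncurry g) :=
    hF.comp (contDiff_fst.add (contDiff_snd.smul contDiff_const))
  let G : E → ℝ := fun p => (H ⋆[ContinuousLinearMap.mul ℝ ℝ, volume] g p) 0
  have hG : ContDiffOn ℝ ∞ G B :=
    contDiffOn_convolution_right_with_param_comp (n := ⊤) (ContinuousLinearMap.mul ℝ ℝ)
      contDiffOn_const Metric.isOpen_ball (isCompact_closedBall _ _) hgs hH hgd.contDiffOn
  refine ⟨G, t ∩ B, hto.inter Metric.isOpen_ball, ⟨hzt, Metric.mem_ball_self one_pos⟩,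
    hG.mono Set.inter_subset_right, fun z hz => ?_⟩
  rw [← ht z hz.1]
  have hGd : DifferentiableAt ℝ G z :=
    (hG.contDiffAt (Metric.isOpen_ball.mem_nhds hz.2)).differentiableAt (by simp)
  have hgz : ContDiff ℝ ∞ (g z) := hgd.comp (contDiff_const.prodMk contDiff_id)
  have hgc : HasCompactSupport (g z) :=
    HasCompactSupport.intro (isCompact_closedBall _ _) fun τ hτ => hgs z τ hz.2 hτ
  have h1 := hgc.hasDerivAt_convolution_right (ContinuousLinearMap.mul ℝ ℝ) hH
    (hgz.of_le (by simp)) 0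
  have h2 : (H ⋆[ContinuousLinearMap.mul ℝ ℝ, volume] deriv (g z)) 0 = F z := by
    have : ∀ τ, (ContinuousLinearMap.mul ℝ ℝ (H τ)) (deriv (g z) (0 - τ)) =
        Set.indicator (Set.Ioi 0) (fun τ => deriv (g z) (-τ)) τ := by
      intro τ
      by_cases hτ : τ ∈ Set.Ioi (0 : ℝ) <;> simp [H, hτ]
    rw [convolution_def]
    simp only [this]
    rw [integral_indicator measurableSet_Ioi, integral_comp_neg_Ioi,
      hgc.integral_Iic_deriv_eq (hgz.of_le (by simp))]
    simp [g]
  rw [h2] at h1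
  -- Moving the base point along `v` amounts to moving the point at which the convolution is
  -- evaluated, so the derivative of `G` along `v` is `h1`.
  have h3 : ∀ h : ℝ, G (z + h • v) = (H ⋆[ContinuousLinearMap.mul ℝ ℝ, volume] g z) h := by
    intro h
    simp only [G, convolution_def]
    congr 1
    ext τ
    have : g (z + h • v) (0 - τ) = g z (h - τ) := by
      simp only [g]
      congr 1
      module
    rw [this]
  have h4 : HasDerivAt (fun h : ℝ => G (z + h • v)) (F z) 0 := by
    simpa only [h3] using h1
  have h5 : HasDerivAt (fun h : ℝ => G (z + h • v)) (fderiv ℝ G z v) 0 := by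
    have hl : HasDerivAt (fun h : ℝ => z + h • v) v 0 := by
      simpa using ((hasDerivAt_id (0 : ℝ)).smul_const v).const_add z
    have hGd' : HasFDerivAt G (fderiv ℝ G z) (z + (0 : ℝ) • v) := by
      simpa using hGd.hasFDerivAt
    exact hGd'.comp_hasDerivAt 0 hl
  exact h5.unique h4

end PartialPrimitive

/-! ### Exchanging one coordinate function of a chart. -/

section ReplaceCoordinate

variable {n : ℕ} {M : Type*} [TopologicalSpace M] [ChartedSpace (EuclideanSpace ℝ (Fin n)) M]
  {e : OpenPartialHomeomorph M (EuclideanSpace ℝ (Fin n))}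

/-- The map replacing the `i`-th coordinate by a function, up to a constant. -/
def replaceCoord (g : EuclideanSpace ℝ (Fin n) → ℝ) (i : Fin n) (c : EuclideanSpace ℝ (Fin n)) :
    EuclideanSpace ℝ (Fin n) → EuclideanSpace ℝ (Fin n) :=
  fun z => z + (g z - z i) • EuclideanSpace.single i 1 - c

/-- The derivative is `id + (dg - dzᵢ) ⊗ eᵢ`. A kernel vector is a multiple `-a eᵢ`, and comparing
`i`-th entries forces `a ∂ᵢg = 0`. -/
theorem exists_hasFDerivAt_replaceCoord {g : EuclideanSpace ℝ (Fin n) → ℝ} {i : Fin n}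
    (c : EuclideanSpace ℝ (Fin n)) {z : EuclideanSpace ℝ (Fin n)} (hg : DifferentiableAt ℝ g z)
    (hne : fderiv ℝ g z (EuclideanSpace.single i 1) ≠ 0) :
    ∃ A : EuclideanSpace ℝ (Fin n) ≃L[ℝ] EuclideanSpace ℝ (Fin n),
      HasFDerivAt (replaceCoord g i c) (A : _ →L[ℝ] EuclideanSpace ℝ (Fin n)) z := by
  let p : EuclideanSpace ℝ (Fin n) →L[ℝ] ℝ := EuclideanSpace.proj i
  let A₀ : EuclideanSpace ℝ (Fin n) →L[ℝ] EuclideanSpace ℝ (Fin n) :=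
    ContinuousLinearMap.id ℝ _ + (fderiv ℝ g z - p).smulRight (EuclideanSpace.single i 1)
  have hinj : LinearMap.ker A₀.toLinearMap = ⊥ := by
    rw [LinearMap.ker_eq_bot']
    intro w hw
    have hw' : w + (fderiv ℝ g z w - w i) • EuclideanSpace.single i (1 : ℝ) = 0 := hw
    set a := fderiv ℝ g z w - w i with ha
    have hwa : w = (-a) • EuclideanSpace.single i (1 : ℝ) := by
      rw [neg_smul]; exact eq_neg_of_add_eq_zero_left hw'
    have hwi : w i = -a := by rw [hwa]; simp
    have hd : fderiv ℝ g z w = -a * fderiv ℝ g z (EuclideanSpace.single i 1) := by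
      conv_lhs => rw [hwa]
      rw [map_smul, smul_eq_mul]
    have h0 : a * fderiv ℝ g z (EuclideanSpace.single i 1) = 0 := by
      rw [hwi, hd] at ha
      linarith
    have := (mul_eq_zero.1 h0).resolve_right hne
    rw [hwa, this]
    simp
  let A := (LinearEquiv.ofInjectiveEndo A₀.toLinearMap
    (LinearMap.ker_eq_bot.1 hinj)).toContinuousLinearEquiv
  have hA : (A : EuclideanSpace ℝ (Fin n) →L[ℝ] EuclideanSpace ℝ (Fin n)) = A₀ :=
    ContinuousLinearMap.ext fun _ => rfl
  refine ⟨A, ?_⟩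
  rw [hA]
  exact ((hasFDerivAt_id z).add
    ((hg.hasFDerivAt.sub p.hasFDerivAt).smul_const (EuclideanSpace.single i (1 : ℝ)))).sub_const c

theorem contDiffOn_replaceCoord {g : EuclideanSpace ℝ (Fin n) → ℝ} {i : Fin n}
    (c : EuclideanSpace ℝ (Fin n)) {s : Set (EuclideanSpace ℝ (Fin n))}
    (hg : ContDiffOn ℝ ∞ g s) : ContDiffOn ℝ ∞ (replaceCoord g i c) s := by
  have hp : ContDiff ℝ ∞ (fun z : EuclideanSpace ℝ (Fin n) => z i) :=
    (EuclideanSpace.proj i : EuclideanSpace ℝ (Fin n) →L[ℝ] ℝ).contDiff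
  exact (contDiffOn_id.add ((hg.sub hp.contDiffOn).smul contDiffOn_const)).sub contDiffOn_const

variable [IsManifold (𝓡 n) ∞ M]

/-- A chart remains a chart if the `i`-th coordinate is replaced by a smooth function with nonzero
`i`-th partial derivative; coordinates may be shifted to centre it. -/
theorem exists_chart_replaceCoord (he : e ∈ IsManifold.maximalAtlas (𝓡 n) ∞ M) {x₀ : M}
    (hx₀ : x₀ ∈ e.source) {f : M → ℝ} {U : Set M} (hU : IsOpen U) (hxU : x₀ ∈ U)
    (hf : SmoothFun n f U) (i : Fin n)
    (hne : differential n f x₀ (pullField e (fun _ => EuclideanSpace.single i 1) x₀) ≠ 0) :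
    ∃ u ∈ IsManifold.maximalAtlas (𝓡 n) ∞ M, x₀ ∈ u.source ∧ u x₀ = 0 ∧
      u.source ⊆ e.source ∩ U ∧ ∀ x ∈ u.source,
        differential n (fun y => u y i) x = differential n f x ∧
        ∀ j ≠ i, differential n (fun y => u y j) x = differential n (fun y => e y j) x := by
  set g := f ∘ e.symm with hg
  set s := e.target ∩ e.symm ⁻¹' U with hs
  have hso : IsOpen s := e.isOpen_inter_preimage_symm hU
  have hzs : e x₀ ∈ s := ⟨e.map_source hx₀, by simpa [e.left_inv hx₀]⟩
  have hgs : ContDiffOn ℝ ∞ g s := contDiffOn_comp_symm he hf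
  have hne' : fderiv ℝ g (e x₀) (EuclideanSpace.single i 1) ≠ 0 := by
    rwa [differential_eq he hU hf hx₀ hxU, LinearMap.comp_apply,
      chartDeriv_pullField he _ hx₀] at hne
  have hcont : ContinuousOn (fun z => fderiv ℝ g z (EuclideanSpace.single i 1)) s :=
    (hgs.continuousOn_fderiv_of_isOpen hso (by simp)).clm_apply continuousOn_const
  -- On this set the derivative of the new map is invertible at every point, so the local inverse is
  -- smooth on its whole domain and not only at the image of `e x₀`.
  set s' := s ∩ (fun z => fderiv ℝ g z (EuclideanSpace.single i 1)) ⁻¹' {0}ᶜ with hs'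
  have hs'o : IsOpen s' := hcont.isOpen_inter_preimage hso isOpen_compl_singleton
  have hzs' : e x₀ ∈ s' := ⟨hzs, hne'⟩
  set c := replaceCoord g i 0 (e x₀) with hc
  set Ψ := replaceCoord g i c with hΨ
  have hΨs : ContDiffOn ℝ ∞ Ψ s := contDiffOn_replaceCoord c hgs
  have hΨd : ∀ z ∈ s', ∃ A : EuclideanSpace ℝ (Fin n) ≃L[ℝ] EuclideanSpace ℝ (Fin n),
      HasFDerivAt Ψ (A : _ →L[ℝ] EuclideanSpace ℝ (Fin n)) z := fun z hz =>
    exists_hasFDerivAt_replaceCoord c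
      ((hgs.contDiffAt (hso.mem_nhds hz.1)).differentiableAt (by simp)) hz.2
  obtain ⟨A, hA⟩ := hΨd _ hzs'
  have hΨat : ContDiffAt ℝ ∞ Ψ (e x₀) := hΨs.contDiffAt (hso.mem_nhds hzs)
  let ψ := (hΨat.toOpenPartialHomeomorph Ψ hA (by simp)).restrOpen s' hs'o
  have hψ : ∀ z, ψ z = Ψ z := fun z => rfl
  have hψs : ψ.source ⊆ s' := fun z hz => hz.2
  have hψx : e x₀ ∈ ψ.source :=
    ⟨hΨat.mem_toOpenPartialHomeomorph_source hA (by simp), hzs'⟩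
  have hψ1 : ContDiffOn ℝ ∞ ψ ψ.source := hΨs.mono fun z hz => (hψs hz).1
  have hψ2 : ContDiffOn ℝ ∞ ψ.symm ψ.target := by
    intro z hz
    have hz' := hψs (ψ.map_target hz)
    obtain ⟨B, hB⟩ := hΨd _ hz'
    exact (ψ.contDiffAt_symm hz hB (hΨs.contDiffAt (hso.mem_nhds hz'.1))).contDiffWithinAt
  let u := e.trans ψ
  have hue : ∀ x ∈ u.source, x ∈ e.source ∧ e x ∈ ψ.source := fun x hx => by
    simpa [u, OpenPartialHomeomorph.trans_source] using hx
  have hux : ∀ x ∈ e.source, e x ∈ ψ.source → x ∈ u.source := fun x h1 h2 => by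
    simp [u, h1, h2]
  have hval : ∀ x ∈ u.source, ∀ j, u x j = (if j = i then f x else e x j) - c j := by
    intro x hx j
    change (e x + (f (e.symm (e x)) - e x i) • EuclideanSpace.single i (1 : ℝ) - c) j = _
    rw [e.left_inv (hue x hx).1]
    by_cases hj : j = i
    · subst hj; simp
    · simp [hj]
  have hdsub : ∀ (h : M → ℝ) (a : ℝ) (x : M), MDifferentiableAt (𝓡 n) 𝓘(ℝ, ℝ) h x →
      differential n (fun y => h y - a) x = differential n h x := by
    intro h a x hh
    have := mfderiv_sub hh (mdifferentiableAt_const (c := a))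
    unfold differential
    congr 1
    refine this.trans ?_
    rw [mfderiv_const]
    exact sub_zero _
  refine ⟨u, ?_, hux _ hx₀ hψx, ?_, ?_, ?_⟩
  · rw [IsManifold.mem_maximalAtlas_iff_contMDiffOn]
    constructor
    · exact (contMDiffOn_comp_chart he hψ1).mono fun x hx => hue x hx
    · refine (contMDiffOn_symm_of_mem_maximalAtlas he).comp
        (contMDiffOn_iff_contDiffOn.2 (hψ2.mono ?_)) ?_
      · intro z hz
        exact hz.1
      · intro z hz
        exact hz.2
  · change replaceCoord g i c (e x₀) = 0
    rw [hc]
    simp [replaceCoord]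
  · intro x hx
    have := (hψs (hue x hx).2).1.2
    rw [Set.mem_preimage, e.left_inv (hue x hx).1] at this
    exact ⟨(hue x hx).1, this⟩
  · intro x hx
    have hev : ∀ᶠ y in 𝓝 x, y ∈ u.source := u.open_source.mem_nhds hx
    have hxU' : x ∈ U := by
      have := (hψs (hue x hx).2).1.2
      rwa [Set.mem_preimage, e.left_inv (hue x hx).1] at this
    constructor
    · rw [← hdsub f (c i) x (hf.mdifferentiableAt hU hxU')]
      apply differential_congr
      filter_upwards [hev] with y hy
      simp [hval y hy]
    · intro j hj
      rw [← hdsub (fun y => e y j) (c j) x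
        ((smoothFun_coord he j).mdifferentiableAt e.open_source (hue x hx).1)]
      apply differential_congr
      filter_upwards [hev] with y hy
      simp [hval y hy, hj]

end ReplaceCoordinate

end ConstCoeff
end

noncomputable section

namespace ConstCoeff

/-! ### The surviving component under a change of one covector. -/

section Algebra

variable {T : Type*} [AddCommGroup T] [Module ℝ T]

/-- Expand `w` in the dual basis: the `i`-th term dies because that covector annihilates `V`, and
every other term except that of `k₀` repeats a covector. -/
theorem evalCovectors_update {m : ℕ} {V : ⋀[ℝ]^m T} (b : Module.Basis (Fin (m + 1)) ℝ T)
    (i : Fin (m + 1)) (hi : b.coord i ∈ annihilator V) (k₀ : Fin m) (w : Module.Dual ℝ T) :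
    evalCovectors V (Function.update (fun k => b.coord (i.succAbove k)) k₀ w) =
      w (b (i.succAbove k₀)) * evalCovectors V (fun k => b.coord (i.succAbove k)) := by
  set c : Fin m → Module.Dual ℝ T := fun k => b.coord (i.succAbove k) with hc
  have hw : w = ∑ l, w (b l) • b.coord l := (b.sum_dual_apply_smul_coord w).symm
  have h1 : evalCovectors V (Function.update c k₀ w) =
      ∑ l, w (b l) * evalCovectors V (Function.update c k₀ (b.coord l)) := by
    conv_lhs => rw [hw]
    simp only [evalCovectors_eq]
    rw [AlternatingMap.map_update_sum, LinearMap.sum_apply]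
    refine Finset.sum_congr rfl fun l _ => ?_
    rw [AlternatingMap.map_update_smul]
    rfl
  rw [h1, Fin.sum_univ_succAbove _ i, evalCovectors_eq_zero_of_mem_annihilator _ k₀
    (by rwa [Function.update_self]), mul_zero, zero_add, Finset.sum_eq_single k₀]
  · congr 2
    exact Function.update_eq_self k₀ c
  · intro k _ hk
    rw [evalCovectors_eq, AlternatingMap.map_update_self _ _ hk.symm]
    · exact mul_zero _
  · simp

end Algebra

theorem orderEmbedding_eq_succAbove {m : ℕ} (i : Fin (m + 1)) (I : Fin m ↪o Fin (m + 1))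
    (hI : ∀ k, I k ≠ i) (k : Fin m) : I k = i.succAbove k := by
  refine congrFun ((StrictMono.range_inj I.strictMono (Fin.strictMono_succAbove i)).1 ?_) k
  rw [Fin.range_succAbove]
  refine Set.eq_of_subset_of_ncard_le ?_ ?_
  · rintro _ ⟨k, rfl⟩
    exact hI k
  · rw [← Set.image_univ, Set.ncard_image_of_injective _ I.injective, Set.ncard_univ,
      Set.ncard_compl]
    simp

/-! ### The Poincaré lemma for closed 1-forms. -/

section Primitive

variable {n : ℕ} {M : Type*} [TopologicalSpace M] [ChartedSpace (EuclideanSpace ℝ (Fin n)) M]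
  {e : OpenPartialHomeomorph M (EuclideanSpace ℝ (Fin n))}

theorem pullField_chartDeriv (he : e ∈ IsManifold.maximalAtlas (𝓡 n) ∞ M) {x : M}
    (hx : x ∈ e.source) (v : TangentSpace (𝓡 n) x) :
    pullField e (fun _ => chartDeriv e x v) x = v :=
  (chartDeriv_bijective he hx).1 (chartDeriv_pullField he _ hx)

theorem chartBasis_apply (he : e ∈ IsManifold.maximalAtlas (𝓡 n) ∞ M) {x : M}
    (hx : x ∈ e.source) (i : Fin n) :
    chartBasis he hx i = pullField e (fun _ => EuclideanSpace.single i 1) x := by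
  apply (chartDeriv_bijective he hx).1
  rw [chartDeriv_pullField he _ hx]
  change chartEquiv he hx _ = _
  simp [chartBasis]

variable [IsManifold (𝓡 n) ∞ M]

theorem smoothVF_pullField_const (he : e ∈ IsManifold.maximalAtlas (𝓡 n) ∞ M)
    (v : EuclideanSpace ℝ (Fin n)) : SmoothVF (pullField e fun _ => v) e.source := by
  have h := smoothVF_pullField he (contDiff_const (c := v) (n := ∞)).contDiffOn (s := Set.univ)
  rwa [Set.preimage_univ, Set.inter_univ] at h

theorem mlieBracket_pullField_const (he : e ∈ IsManifold.maximalAtlas (𝓡 n) ∞ M)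
    (v w : EuclideanSpace ℝ (Fin n)) {x : M} (hx : x ∈ e.source) :
    VectorField.mlieBracket (𝓡 n) (pullField e fun _ => v) (pullField e fun _ => w) x = 0 := by
  apply (chartDeriv_bijective he hx).1
  rw [chartDeriv_mlieBracket he e.open_source (smoothVF_pullField_const he v)
    (smoothVF_pullField_const he w) hx hx, map_zero]
  have h : ∀ u : EuclideanSpace ℝ (Fin n),
      pushField e (pullField e fun _ => u) =ᶠ[𝓝 (e x)] fun _ => u := by
    intro u
    filter_upwards [e.open_target.mem_nhds (e.map_source hx)] with z hz
    rw [pushField, chartDeriv_pullField he _ (e.map_target hz)]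
  rw [VectorField.lieBracket, (h v).fderiv_eq, (h w).fderiv_eq]
  simp

/-- The Poincaré lemma for `1`-forms: closed forms are locally exact. -/
theorem ClosedForm.exists_primitive {ζ : OneForm n M} {W : Set M} (hW : IsOpen W)
    (hs : SmoothForm ζ W) (hc : ClosedForm ζ W) {x₀ : M} (hx₀ : x₀ ∈ W) :
    ∃ (U : Set M) (f : M → ℝ), IsOpen U ∧ x₀ ∈ U ∧ U ⊆ W ∧ SmoothFun n f U ∧
      ∀ x ∈ U, differential n f x = ζ x := by
  set e := chartAt (EuclideanSpace ℝ (Fin n)) x₀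
  have he : e ∈ IsManifold.maximalAtlas (𝓡 n) ∞ M := IsManifold.chart_mem_maximalAtlas x₀
  have hxe : x₀ ∈ e.source := mem_chart_source _ x₀
  have hso : IsOpen (e.target ∩ e.symm ⁻¹' W) := e.isOpen_inter_preimage_symm hW
  obtain ⟨r, hr, hrs⟩ := Metric.isOpen_iff.1 hso (e x₀)
    ⟨e.map_source hxe, by simpa [e.left_inv hxe]⟩
  let β' : M → EuclideanSpace ℝ (Fin n) →ₗ[ℝ] ℝ := fun x =>
    ζ x ∘ₗ ((mfderiv (𝓡 n) 𝓘(ℝ, EuclideanSpace ℝ (Fin n)) e x).inverse :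
      EuclideanSpace ℝ (Fin n) →L[ℝ] TangentSpace (𝓡 n) x).toLinearMap
  have hβ' : ∀ x v, β' x v = ζ x (pullField e (fun _ => v) x) := fun _ _ => rfl
  let β : EuclideanSpace ℝ (Fin n) → EuclideanSpace ℝ (Fin n) →L[ℝ] ℝ :=
    fun z => LinearMap.toContinuousLinearMap (β' (e.symm z))
  have hWe : IsOpen (e.source ∩ W) := e.open_source.inter hW
  have hVF : ∀ v, SmoothVF (pullField e fun _ => v) (e.source ∩ W) := fun v =>
    (smoothVF_pullField_const he v).mono Set.inter_subset_left
  have hsm : ∀ v, SmoothFun n (fun x => ζ x (pullField e (fun _ => v) x)) (e.source ∩ W) :=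
    fun v => hs _ hWe Set.inter_subset_right _ (hVF v)
  have hball : Metric.ball (e x₀) r ⊆ e.target ∩ e.symm ⁻¹' (e.source ∩ W) := fun z hz =>
    ⟨(hrs hz).1, e.map_target (hrs hz).1, (hrs hz).2⟩
  have hβ : ContDiffOn ℝ ∞ β (Metric.ball (e x₀) r) :=
    contDiffOn_clm_apply.2 fun v => (contDiffOn_comp_symm he (hsm v)).mono hball
  have hβd : ∀ z ∈ Metric.ball (e x₀) r, DifferentiableAt ℝ β z := fun z hz =>
    (hβ.contDiffAt (Metric.isOpen_ball.mem_nhds hz)).differentiableAt (by simp)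
  have hder : ∀ z ∈ Metric.ball (e x₀) r, ∀ v w, fderiv ℝ β z v w =
      lieDer (pullField e fun _ => v) (fun x => ζ x (pullField e (fun _ => w) x)) (e.symm z) := by
    intro z hz v w
    have hz' := hball hz
    rw [lieDer, differential_eq he hWe (hsm w) hz'.2.1 hz'.2, LinearMap.comp_apply,
      chartDeriv_pullField he _ hz'.2.1, e.right_inv hz'.1]
    have : fderiv ℝ (fun y => β y w) z v = fderiv ℝ β z v w := by
      rw [fderiv_clm_apply (hβd z hz) (differentiableAt_const w)]
      simp
    exact this.symm
  -- Symmetry of the derivative of `β` is closedness tested on constant fields, whose bracket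
  -- vanishes.
  obtain ⟨φ, hφ⟩ := (convex_ball (e x₀) r).exists_forall_hasFDerivAt_of_fderiv_symmetric
    Metric.isOpen_ball (fun z hz => (hβd z hz).differentiableWithinAt) (by
      intro z hz v w
      have hz' := hball hz
      have h := hc _ hWe Set.inter_subset_right _ _ (hVF v) (hVF w) _ hz'.2
      rw [mlieBracket_pullField_const he v w hz'.2.1, map_zero, sub_zero] at h
      rw [hder z hz, hder z hz]
      exact sub_eq_zero.1 h)
  have hφs : ContDiffOn ℝ ∞ φ (Metric.ball (e x₀) r) := by
    rw [contDiffOn_infty_iff_fderiv_of_isOpen Metric.isOpen_ball]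
    exact ⟨fun z hz => (hφ z hz).differentiableAt.differentiableWithinAt,
      hβ.congr fun z hz => (hφ z hz).fderiv⟩
  refine ⟨e.source ∩ e ⁻¹' Metric.ball (e x₀) r, fun x => φ (e x),
    e.isOpen_inter_preimage Metric.isOpen_ball, ⟨hxe, Metric.mem_ball_self hr⟩, ?_,
    contMDiffOn_comp_chart he hφs, ?_⟩
  · intro x hx
    have := (hball hx.2).2.2
    rwa [e.left_inv hx.1] at this
  · intro x hx
    rw [differential_comp_chart he hx.1 (hφ _ hx.2).differentiableAt, (hφ _ hx.2).fderiv]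
    refine LinearMap.ext fun v => ?_
    change β' (e.symm (e x)) (chartDeriv e x v) = ζ x v
    rw [e.left_inv hx.1, hβ', pullField_chartDeriv he hx.1]

end Primitive

/-! ### Construction of the coordinates and the equivalence. -/

section Main

variable {m : ℕ} {M : Type*} [TopologicalSpace M] [ChartedSpace (EuclideanSpace ℝ (Fin (m + 1))) M]
  [IsManifold (𝓡 (m + 1)) ∞ M]

/-- An `m`-vector on a space of dimension `m + 1` annihilated by the `i`-th coordinate covector is
determined by one component. -/
theorem evalCovectors_succAbove_ne_zero {T : Type*} [AddCommGroup T] [Module ℝ T]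
    {V : ⋀[ℝ]^m T} (b : Module.Basis (Fin (m + 1)) ℝ T) (i : Fin (m + 1))
    (hi : b.coord i ∈ annihilator V) (hV : V ≠ 0) :
    evalCovectors V (fun k => b.coord (i.succAbove k)) ≠ 0 := by
  intro h0
  apply hV
  apply eq_of_evalCovectors_eq b
  intro I
  have hz : evalCovectors (0 : ⋀[ℝ]^m T) (fun k => b.coord (I k)) = 0 := map_zero _
  rw [hz]
  by_cases hI : ∃ k, I k = i
  · obtain ⟨k, hk⟩ := hI
    exact evalCovectors_eq_zero_of_mem_annihilator _ k (by rwa [hk])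
  · push Not at hI
    simpa only [orderEmbedding_eq_succAbove i I hI] using h0

/-- Near a point, the Pfaffian system contains a nonvanishing exact form. -/
theorem exists_exact_mem_pfaffian {V : MVField (m + 1) M m} {U : Set M}
    (hP : HasLocalClosedBases (pfaffian V) U) {x₀ : M} (hx₀ : x₀ ∈ U) :
    ∃ (W : Set M) (f : M → ℝ), IsOpen W ∧ x₀ ∈ W ∧ SmoothFun (m + 1) f W ∧
      differential (m + 1) f x₀ ≠ 0 ∧ ∀ x ∈ W, differential (m + 1) f x ∈ pfaffian V x := by
  obtain ⟨W, hW, hxW, -, k, ζ, hζ, hspan⟩ := hP x₀ hx₀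
  have he := IsManifold.chart_mem_maximalAtlas (I := 𝓡 (m + 1)) (n := ∞) x₀
  have hxe := mem_chart_source (EuclideanSpace ℝ (Fin (m + 1))) x₀
  have : FiniteDimensional ℝ (TangentSpace (𝓡 (m + 1)) x₀) :=
    (chartEquiv he hxe).symm.finiteDimensional
  -- This nonvanishing makes the closed frame nonempty; any of its members has a suitable primitive.
  have hbot : pfaffian V x₀ ≠ ⊥ := annihilator_ne_bot
    (by rw [(chartEquiv he hxe).finrank_eq, finrank_euclideanSpace_fin]) _
  have hk : Nonempty (Fin k) := by
    by_contra hk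
    rw [not_nonempty_iff] at hk
    apply hbot
    rw [← (hspan x₀ hxW).2, Set.range_eq_empty, Submodule.span_empty]
  obtain ⟨j⟩ := hk
  obtain ⟨U', f, hU', hxU', hU'W, hf, hdf⟩ :=
    (hζ j).2.exists_primitive hW (hζ j).1 hxW
  refine ⟨U', f, hU', hxU', hf, ?_, fun x hx => ?_⟩
  · rw [hdf x₀ hxU']
    exact (hspan x₀ hxW).1.ne_zero j
  · rw [hdf x hx, ← (hspan x (hU'W hx)).2]
    exact Submodule.subset_span ⟨j, rfl⟩

/-- There are coordinates one of whose differentials lies in the Pfaffian system. -/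
theorem exists_chart_mem_pfaffian {V : MVField (m + 1) M m} {U : Set M}
    (hP : HasLocalClosedBases (pfaffian V) U) {x₀ : M} (hx₀ : x₀ ∈ U) :
    ∃ e ∈ IsManifold.maximalAtlas (𝓡 (m + 1)) ∞ M, x₀ ∈ e.source ∧ ∃ i : Fin (m + 1),
      ∀ x ∈ e.source, differential (m + 1) (fun y => e y i) x ∈ pfaffian V x := by
  obtain ⟨W, f, hW, hxW, hf, hne, hmem⟩ := exists_exact_mem_pfaffian hP hx₀
  have he := IsManifold.chart_mem_maximalAtlas (I := 𝓡 (m + 1)) (n := ∞) x₀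
  have hxe := mem_chart_source (EuclideanSpace ℝ (Fin (m + 1))) x₀
  obtain ⟨i, hi⟩ : ∃ i, differential (m + 1) f x₀ (chartBasis he hxe i) ≠ 0 := by
    by_contra! h
    exact hne ((chartBasis he hxe).ext fun i => by rw [h i, LinearMap.zero_apply])
  rw [chartBasis_apply] at hi
  obtain ⟨u, hu, hxu, -, hsub, hd⟩ := exists_chart_replaceCoord he hxe hW hxW hf i hi
  refine ⟨u, hu, hxu, i, fun x hx => ?_⟩
  rw [(hd x hx).1]
  exact hmem x (hsub hx).2

/-- With the `i`-th coordinate adapted to the Pfaffian system, only the component `K` omitting `i`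
can be nonzero, and rescaling along one other coordinate turns it into `1`. -/
theorem hasConstantCoefficientsNear_of_hasLocalClosedBases (hm : 1 ≤ m) {V : MVField (m + 1) M m}
    (hV : SmoothMV V Set.univ) {U : Set M} (hP : HasLocalClosedBases (pfaffian V) U) {x₀ : M}
    (hx₀ : x₀ ∈ U) (hVx₀ : V x₀ ≠ 0) : HasConstantCoefficientsNear V x₀ := by
  obtain ⟨e, he, hxe, i, hi⟩ := exists_chart_mem_pfaffian hP hx₀
  -- Dimension at least two provides a coordinate index `j` different from `i`.
  let k₀ : Fin m := ⟨0, hm⟩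
  let j := i.succAbove k₀
  let K : M → ℝ := fun x =>
    evalCovectors (V x) fun k => differential (m + 1) (fun y => e y (i.succAbove k)) x
  have hK : SmoothFun (m + 1) K e.source :=
    hV _ e.open_source (Set.subset_univ _) _ fun k => smoothFun_coord he (i.succAbove k)
  have hcoord : ∀ x (hx : x ∈ e.source), (chartBasis he hx).coord i ∈ annihilator (V x) := by
    intro x hx
    rw [chartBasis_coord]
    exact hi x hx
  have hKx₀ : K x₀ ≠ 0 := by
    have := evalCovectors_succAbove_ne_zero (chartBasis he hxe) i (hcoord x₀ hxe) hVx₀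
    simpa only [chartBasis_coord] using this
  set N : Set M := e.source ∩ K ⁻¹' {0}ᶜ with hN
  have hNo : IsOpen N := hK.continuousOn.isOpen_inter_preimage e.open_source isOpen_compl_singleton
  have hKN : SmoothFun (m + 1) (fun x => (K x)⁻¹) N :=
    ContMDiffOn.inv₀ (hK.mono Set.inter_subset_left) fun x hx => hx.2
  have hso : IsOpen (e.target ∩ e.symm ⁻¹' N) := e.isOpen_inter_preimage_symm hNo
  obtain ⟨G, t, ht, hxt, hG, hGd⟩ := exists_partial_primitive hso (z₀ := e x₀)
    ⟨e.map_source hxe, by rw [Set.mem_preimage, e.left_inv hxe]; exact ⟨hxe, hKx₀⟩⟩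
    (contDiffOn_comp_symm he hKN) (v := EuclideanSpace.single j 1) (by simp)
  have hsub0 : e.source ∩ e ⁻¹' t ⊆ e.source := Set.inter_subset_left
  have hGs : SmoothFun (m + 1) (fun x => G (e x)) (e.source ∩ e ⁻¹' t) :=
    contMDiffOn_comp_chart he hG
  have hdG : ∀ x ∈ e.source ∩ e ⁻¹' t, differential (m + 1) (fun x => G (e x)) x
      (pullField e (fun _ => EuclideanSpace.single j 1) x) = (K x)⁻¹ := by
    intro x hx
    rw [differential_comp_chart he hx.1
      ((hG.contDiffAt (ht.mem_nhds hx.2)).differentiableAt (by simp)), LinearMap.comp_apply,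
      chartDeriv_pullField he _ hx.1]
    refine (hGd _ hx.2).trans ?_
    rw [Function.comp_apply, e.left_inv hx.1]
  have hopen : IsOpen ((e.source ∩ e ⁻¹' t) ∩ N) :=
    (e.isOpen_inter_preimage ht).inter hNo
  obtain ⟨u, hu, hxu, hu0, husub, hud⟩ := exists_chart_replaceCoord he hxe hopen
    ⟨⟨hxe, hxt⟩, hxe, hKx₀⟩ (hGs.mono Set.inter_subset_left) j
    (by rw [hdG x₀ ⟨hxe, hxt⟩]; exact inv_ne_zero hKx₀)
  refine ⟨u, hu, hxu, hu0, fun I => ?_⟩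
  by_cases hI : ∃ k, I k = i
  · obtain ⟨k, hk⟩ := hI
    refine ⟨0, fun x hx => evalCovectors_eq_zero_of_mem_annihilator _ k ?_⟩
    simp only [hk]
    -- Since `j ≠ i`, the exchange leaves the `i`-th differential, and hence its membership in the
    -- Pfaffian system, untouched.
    rw [(hud x hx).2 i (Fin.succAbove_ne i k₀).symm]
    exact hi x (husub hx).1
  · push Not at hI
    refine ⟨1, fun x hx => ?_⟩
    have hxe' : x ∈ e.source := (husub hx).1
    have hupd : (fun k => differential (m + 1) (fun y => u y (I k)) x) =
        Function.update (fun k => (chartBasis he hxe').coord (i.succAbove k)) k₀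
          (differential (m + 1) (fun x => G (e x)) x) := by
      funext k
      rw [orderEmbedding_eq_succAbove i I hI]
      by_cases hk : k = k₀
      · subst hk
        rw [Function.update_self]
        exact (hud x hx).1
      · rw [Function.update_of_ne hk, chartBasis_coord]
        exact (hud x hx).2 _ fun h => hk (Fin.succAbove_right_injective h)
    rw [hupd, evalCovectors_update _ i (hcoord x hxe'), chartBasis_apply, hdG x (husub hx).2.1]
    simp only [chartBasis_coord]
    exact inv_mul_cancel₀ (husub hx).2.2.2

end Main

end ConstCoeff

end

theorem proposition1p16 {m : ℕ} (hm : 1 ≤ m) {M : Type*} [TopologicalSpace M] [T2Space M]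
    [ChartedSpace (EuclideanSpace ℝ (Fin (m + 1))) M] [IsManifold (𝓡 (m + 1)) ∞ M]
    (V : ConstCoeff.MVField (m + 1) M m) (hV : ConstCoeff.SmoothMV V Set.univ)
    (x₀ : M) (hx₀ : V x₀ ≠ 0) :
    ConstCoeff.HasConstantCoefficientsNear V x₀ ↔
      ∃ U : Set M, IsOpen U ∧ x₀ ∈ U ∧
        (ConstCoeff.LocallyConstantRank (ConstCoeff.pfaffian V) U ∧
          ConstCoeff.HasLocalClosedBases (ConstCoeff.pfaffian V) U ∧
          ConstCoeff.IsIntegrable (ConstCoeff.pfaffian V) U) ∧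
        ∃ D : ConstCoeff.DerivationLaw (m + 1) M (m + 1) U, D.IsFlat ∧
          ∀ X Y : ConstCoeff.VField (m + 1) M,
            ConstCoeff.SmoothVF X U → ConstCoeff.SmoothVF Y U →
            ∀ x ∈ U, D.extCovDeriv (ConstCoeff.wedgeForm V) X Y x = 0 := by
  constructor
  · rintro ⟨u, hu, hxu, -, hconst⟩
    have hV₀ := ConstCoeff.exists_map_chartDeriv_eq hu hconst hxu
    exact ⟨u.source, u.open_source, hxu, ConstCoeff.pfaffian_of_constant hu hV₀,
      ConstCoeff.chartLaw hu, ConstCoeff.isFlat_chartLaw hu, fun X Y hX hY x hx =>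
        ConstCoeff.extCovDeriv_chartLaw hu hV₀ hX hY hx⟩
  · rintro ⟨U, -, hxU, ⟨-, hP, -⟩, -⟩
    exact ConstCoeff.hasConstantCoefficientsNear_of_hasLocalClosedBases hm hV hP hxU hx₀
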